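/- **Setting.** Fix integers $S,A\ge 1$, a horizon $H\in(0,\infty)$ and constants $0<\lambda_{\min}\le\lambda_{\max}<\infty$. A finite-horizon continuous-time Markov decision process (CTMDP) $\mathcal M$ with $S$ states and $A$ actions is given by reward rates $r(x,a)$, holding-time rates $\lambda(x,a)>0$, transition probabilities $p(\cdot\mid x,a)$ and an initial state $x_0$. If action $a$ is taken in state $x$, the process stays in $x$ for an exponential time of rate $\lambda(x,a)$, earning reward at rate $r(x,a)$, and then jumps to a state drawn, independently, from $p(\cdot\mid x,a)$; a jump leads to a different state, i.e. $p(x\mid x,a)=0$ for all $a$, unless $x$ is absorbing, i.e. $p(x\mid x,a)=1$ for all $a$. A new action is chosen after each jump. Let $\mathcal C$ be the class of such CTMDPs with $\lambda(x,a)\in[\lambda_{\min},\lambda_{\max}]$ and $r(x,a)\in[0,1]$ for all $(x,a)$. A policy is a measurable map $\pi$ from (state, remaining time in $[0,H]$) to actions; $V^\pi(x_0,H)$ is the expected reward it accrues over $[0,H]$ from $x_0$, and $V^*(x_0,H)=\sup_\pi V^\pi(x_0,H)$. An algorithm, which may use the reward function and the initial state (as well as $S,A,H,\lambda_{\min},\lambda_{\max}$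 and the number $K$ of episodes) and may randomize, executes in episode $k=1,\dots,K$ a policy $\pi_k$ that is a measurable function of the data of episodes $1,\dots,k-1$ (states, actions and holding times observed up to time $H$), every episode starting anew from $x_0$. Its regret is $$\mathrm{Regret}(\mathcal M,\mathrm{algo},K)=\mathbb E\Big[\sum_{k=1}^K V^*(x_0,H)-\sum_{k=1}^K V^{\pi_k}(x_0,H)\Big].$$ **Theorem.** Let $S\ge 6$, $A\ge 2$, and let $d$ be an integer such that $S=2+\frac{A^d-1}{A-1}$. Then for every algorithm and every $K\ge SA/2$ there exists $\mathcal M\in\mathcal C$ such that $$\mathrm{Regret}(\mathcal M,\mathrm{algo},K)\ \ge\ \frac{1}{12\sqrt2}\,\mathbb E\big[(H-\gamma_d)^+\big]\sqrt{SAK},$$ where $\gamma_d$ has the Erlang distribution with shape parameter $d$ and rate parameter $\lambda_{\max}$. Moreover, if $d<(1-c_2)\lambda_{\max}H$ for some $c_2\in(0,1)$, then, for the same $\mathcal M$, $$\mathrm{Regret}(\mathcal M,\mathrm{algo},K)\ \ge\ \frac{c_2}{12\sqrt2}\,H\sqrt{SAK}.$$ -/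

import Mathlib

open MeasureTheory ProbabilityTheory Set

noncomputable section

/-- A controller of one episode: given the current state and the remaining time, it returns an
action. -/
abbrev ControlMap (S A : ℕ) : Type := Fin S → ℝ → Fin A

/-- A deterministic Markov policy: a measurable control map. It is only ever evaluated at
remaining times lying in `[0, H]`. -/
abbrev Policy (S A : ℕ) : Type := {π : ControlMap S A // ∀ x, Measurable (π x)}

/-- A continuous-time Markov decision process with `S` states and `A` actions (the length of the
horizon is passed separately). `rate x a` is the rate of the exponential holding time, `p x a` the
law of the state entered at the end of that holding time. A jump leads to another state, except
from states that are absorbing. -/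
structure CTMDP (S A : ℕ) where
  /-- reward rates -/
  r : Fin S → Fin A → ℝ
  /-- holding-time rates -/
  rate : Fin S → Fin A → ℝ
  /-- transition probabilities -/
  p : Fin S → Fin A → PMF (Fin S)
  /-- initial state -/
  x₀ : Fin S
  rate_pos : ∀ x a, 0 < rate x a
  jump_or_absorbing : ∀ x, (∀ a, p x a x = 0) ∨ (∀ a, p x a x = 1)

/-- The class of CTMDPs with `S` states and `A` actions whose holding-time rates lie in
`[rateMin, rateMax]` and whose reward rates lie in `[0, 1]`. -/
def ctmdpClass (S A : ℕ) (rateMin rateMax : ℝ) : Set (CTMDP S A) :=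
  {M | (∀ x a, M.rate x a ∈ Icc rateMin rateMax) ∧ (∀ x a, M.r x a ∈ Icc (0 : ℝ) 1)}

/-- The randomness that drives one episode: if action `a` is taken in state `x` after the `n`-th
jump, then the next holding time and the next state are the two components of `ω n x a`. -/
abbrev Noise (S A : ℕ) : Type := ℕ → Fin S → Fin A → ℝ × Fin S

/-- What is recorded of one episode. The `n`-th entry is (state, action, observed holding time)
after the `n`-th jump; the right summand `Unit` means that this jump was not observed. -/
abbrev EpisodeData (S A : ℕ) : Type := ℕ → (Fin S × Fin A × ℝ) ⊕ Unit

/-- A learning algorithm. It knows the reward function and the initial state, and maps these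
and the data of the previous `k` episodes to the policy executed in the next episode. It may
randomize, by means of a real random seed (a deterministic algorithm ignores the seed). As the
numbers of states and actions, the horizon, the bounds on the rates and the number of episodes
are fixed in advance, the algorithm may depend on these as well. -/
structure Algorithm (S A : ℕ) where
  /-- law of the random seed -/
  seedLaw : Measure ℝ
  isProbabilityMeasure_seedLaw : IsProbabilityMeasure seedLaw
  /-- `policy r x₀ k (seed, data)` is the policy after `k` observed episodes -/
  policy : (Fin S → Fin A → ℝ) → Fin S → (k : ℕ) →
    ℝ × (Fin k → EpisodeData S A) → ControlMap S A
  measurable_policy : ∀ r x₀ k x,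
    Measurable fun q : (ℝ × (Fin k → EpisodeData S A)) × ℝ => policy r x₀ k q.1 x q.2

namespace CTMDP

variable {S A : ℕ} (M : CTMDP S A)

/-- Joint law of (holding time, next state) for a state-action pair: the two are independent, the
first one is exponential with rate `M.rate x a`, the second one has law `M.p x a`. -/
def stepLaw (x : Fin S) (a : Fin A) : Measure (ℝ × Fin S) :=
  (expMeasure (M.rate x a)).prod (M.p x a).toMeasure

instance (x : Fin S) (a : Fin A) : IsProbabilityMeasure (M.stepLaw x a) := by
  have := isProbabilityMeasure_expMeasure (M.rate_pos x a)
  unfold stepLaw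
  infer_instance

/-- The law of the noise: all entries are independent, with the step laws as marginals. Hence,
given the past of the episode, (holding time, next state) has law `M.stepLaw x a` for the current
state-action pair `(x, a)`. -/
def noiseLaw : Measure (Noise S A) :=
  Measure.infinitePi fun _ : ℕ => Measure.pi fun x => Measure.pi fun a => M.stepLaw x a

end CTMDP

section Path

variable {S A : ℕ} (π : ControlMap S A) (x : Fin S) (H : ℝ) (ω : Noise S A)

/-- `(xₙ, tₙ)`: the state after the `n`-th jump and the time of the `n`-th jump, under the policy
`π` for a horizon of length `H`, from the state `x` at time `0`. The action taken at time `tₙ` is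
`π xₙ (H - tₙ)⁺`. -/
def jumpPath : ℕ → Fin S × ℝ
  | 0 => (x, 0)
  | n + 1 =>
    let xn := (jumpPath n).1
    let tn := (jumpPath n).2
    let step := ω n xn (π xn (max (H - tn) 0))
    (step.2, tn + step.1)

/-- `xₙ` -/
def stateSeq (n : ℕ) : Fin S := (jumpPath π x H ω n).1

/-- `tₙ` -/
def timeSeq (n : ℕ) : ℝ := (jumpPath π x H ω n).2

/-- `aₙ` -/
def actionSeq (n : ℕ) : Fin A := π (stateSeq π x H ω n) (max (H - timeSeq π x H ω n) 0)

/-- `r (X(u), A(u))`: the reward rate at time `u`, equal to `r xₙ aₙ` for `u ∈ [tₙ, tₙ₊₁)`. -/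
def rewardRate (r : Fin S → Fin A → ℝ) (u : ℝ) : ℝ :=
  ∑' n, (Ico (timeSeq π x H ω n) (timeSeq π x H ω (n + 1))).indicator
    (fun _ => r (stateSeq π x H ω n) (actionSeq π x H ω n)) u

/-- The data observed up to time `H`: the state-action pairs taken at jump times `tₙ ≤ H`, and the
holding times, the last of which is truncated at `H`. -/
def observe : EpisodeData S A := fun n =>
  if timeSeq π x H ω n ≤ H then
    Sum.inl (stateSeq π x H ω n, actionSeq π x H ω n,
      min (timeSeq π x H ω (n + 1)) H - timeSeq π x H ω n)
  else Sum.inr ()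

end Path

namespace CTMDP

variable {S A : ℕ} (M : CTMDP S A)

/-- The value function of a policy: expected reward accrued over the horizon `[0, H]` from the
state `x`. -/
def value (H : ℝ) (π : ControlMap S A) (x : Fin S) : ℝ :=
  ∫ ω, (∫ u in (0 : ℝ)..H, rewardRate π x H ω M.r u) ∂M.noiseLaw

/-- The optimal value function: the supremum over all deterministic Markov policies. -/
def optValue (H : ℝ) (x : Fin S) : ℝ := ⨆ π : Policy S A, M.value H π.1 x

/-- The law of (seed, data of the first `k` episodes) when the algorithm interacts with `M`. The
episodes are driven by independent noises. -/
def dataLaw (H : ℝ) (algo : Algorithm S A) :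
    (k : ℕ) → Measure (ℝ × (Fin k → EpisodeData S A))
  | 0 => algo.seedLaw.map fun s => (s, Fin.elim0)
  | k + 1 => ((dataLaw H algo k).prod M.noiseLaw).map fun q =>
      (q.1.1, Fin.snoc q.1.2 (observe (algo.policy M.r M.x₀ k q.1) M.x₀ H q.2))

/-- The cumulative expected regret of the algorithm over `K` episodes. In the `k`-th summand
(`k = 0, …, K - 1`) the policy is the one computed from the first `k` episodes. -/
def regret (H : ℝ) (algo : Algorithm S A) (K : ℕ) : ℝ :=
  ∫ h, (∑ _k : Fin K, M.optValue H M.x₀ -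
      ∑ k : Fin K, M.value H
        (algo.policy M.r M.x₀ k (h.1, fun i => h.2 (Fin.castLE k.2.le i))) M.x₀)
    ∂M.dataLaw H algo K

end CTMDP

end

/-! The hard instances are trees. All holding times have rate λ = `rateMax`. In a complete A-ary
tree with d levels, each of the N = A^d pairs (leaf, action) leads to a rewarding or to a worthless
absorbing state with probability 1/2 each, except that one hidden pair z succeeds with probability
1/2 + ε. Under every policy the absorption happens at the d-th jump, whose time is Erlang
(`lintegral_timeSeq_eq_gamma`). With G = E(H - γ_d)⁺, a policy therefore has value G/2 + ε w(z),
where the hit weight w(z) is the expected remaining time at the d-th jump on the event that z was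
played (`value_bias`). The hit weights of all pairs sum to G (`sum_hitWeight`), and some stationary
policy always plays z. So the regret is at least ε (K G - E_z W_z), where W_z is the hit weight of z
summed over the episodes (`le_regret_bias`).

Without bias, the means E_0 W_z sum to at most K G, and the expected numbers E_0 T_z of episodes
that reveal a jump out of z sum to at most K. A typical z is thus neglected, and a small bias at z
cannot be noticed: on the data, the biased law has as density a product of factors 1 ± 2ε, one for
each test of z (`lintegral_observe_bias`, `lintegral_dataLaw_bias`), so the relative entropy is at
most 4 ε² E_0 T_z. A Pinsker-type bound with a free parameter η then gives E_z W_z ≤ E_0 W_z + K G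
(ε² E_0 T_z / η + η) (`integral_dataLaw_bias_le`). Averaging over z yields a pair with regret at
least ε K G (1 - 1/N - ε² K / (η N) - η) (`exists_le_regret`). It remains to take ε = c √(N/K), η =
c with c = 1/(4√2), and to compare N with S A. -/

open scoped ENNReal

/-! ### Product measures: resampling and reweighting one coordinate -/

section ProductMeasure

variable {ι : Type*} [DecidableEq ι] {X : ι → Type*} [∀ i, MeasurableSpace (X i)]

/-- Resampling one coordinate of a product measure does not change it. -/
lemma infinitePi_prod_map_update (μ : ∀ i, Measure (X i)) [∀ i, IsProbabilityMeasure (μ i)]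
    (n : ι) :
    ((Measure.infinitePi μ).prod (μ n)).map (fun q => Function.update q.1 n q.2) =
      Measure.infinitePi μ := by
  have hm : Measurable fun q : (∀ i, X i) × X n => Function.update q.1 n q.2 := by
    rw [measurable_pi_iff]
    intro i
    by_cases h : i = n
    · subst h
      simpa using measurable_snd
    · simp only [Function.update_of_ne h]
      fun_prop
  refine Measure.eq_infinitePi μ fun s t ht => ?_
  have hs : MeasurableSet ((s : Set ι).pi t) := .pi s.countable_toSet fun i _ => ht i
  rw [Measure.map_apply hm hs]
  by_cases hn : n ∈ s
  · have : (fun q : (∀ i, X i) × X n => Function.update q.1 n q.2) ⁻¹' (s : Set ι).pi t =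
        ((s.erase n : Finset ι) : Set ι).pi t ×ˢ t n := by
      ext ⟨ω, y⟩
      simp only [mem_preimage, Set.mem_pi, mem_prod, Finset.mem_coe, Finset.mem_erase]
      constructor
      · intro h
        refine ⟨fun i hi => ?_, ?_⟩
        · simpa [Function.update_of_ne hi.1] using h i hi.2
        · simpa using h n hn
      · rintro ⟨h1, h2⟩ i hi
        by_cases h : i = n
        · subst h; simpa using h2
        · simpa [Function.update_of_ne h] using h1 i ⟨h, hi⟩
    rw [this, Measure.prod_prod, Measure.infinitePi_pi _ (fun i _ => ht i), mul_comm,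
      Finset.mul_prod_erase s (fun i => μ i (t i)) hn]
  · have : (fun q : (∀ i, X i) × X n => Function.update q.1 n q.2) ⁻¹' (s : Set ι).pi t =
        (s : Set ι).pi t ×ˢ univ := by
      ext ⟨ω, y⟩
      simp only [mem_preimage, Set.mem_pi, mem_prod, Finset.mem_coe, mem_univ, and_true]
      refine forall₂_congr fun i hi => ?_
      rw [Function.update_of_ne (by rintro rfl; exact hn hi)]
    rw [this, Measure.prod_prod, Measure.infinitePi_pi _ (fun i _ => ht i)]
    simp

lemma measurable_update_prod (n : ι) :
    Measurable fun q : (∀ i, X i) × X n => Function.update q.1 n q.2 := by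
  rw [measurable_pi_iff]
  intro i
  by_cases h : i = n
  · subst h
    simpa using measurable_snd
  · simp only [Function.update_of_ne h]
    fun_prop

/-- Fubini for a single coordinate, without splitting the index set: integrate over a fresh copy of
that coordinate. -/
lemma lintegral_infinitePi_update (μ : ∀ i, Measure (X i)) [∀ i, IsProbabilityMeasure (μ i)]
    (n : ι) {F : (∀ i, X i) → ℝ≥0∞} (hF : Measurable F) :
    ∫⁻ ω, F ω ∂Measure.infinitePi μ =
      ∫⁻ ω, ∫⁻ y, F (Function.update ω n y) ∂μ n ∂Measure.infinitePi μ := by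
  conv_lhs => rw [← infinitePi_prod_map_update μ n]
  rw [lintegral_map hF (measurable_update_prod n)]
  exact lintegral_prod _ (hF.comp (measurable_update_prod n)).aemeasurable

/-- Changing one factor of a product measure by a density changes the product by that density. -/
lemma infinitePi_withDensity_eval (μ ν : ∀ i, Measure (X i)) [∀ i, IsProbabilityMeasure (μ i)]
    [∀ i, IsProbabilityMeasure (ν i)] (n : ι) {g : X n → ℝ≥0∞} (hg : Measurable g)
    (hn : ν n = (μ n).withDensity g) (hne : ∀ i, i ≠ n → ν i = μ i) :
    Measure.infinitePi ν = (Measure.infinitePi μ).withDensity fun ω => g (ω n) := by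
  symm
  refine Measure.eq_infinitePi ν fun s t ht => ?_
  have hs : MeasurableSet ((s : Set ι).pi t) := .pi s.countable_toSet fun i _ => ht i
  have hs' : MeasurableSet (((s.erase n : Finset ι) : Set ι).pi t) :=
    .pi (s.erase n).countable_toSet fun i _ => ht i
  -- With `univ` in the second case, the box is a condition off `n` times a condition on coordinate
  -- `n`, whether or not `s` contains `n`.
  set u : Set (X n) := if n ∈ s then t n else univ with hu_def
  have hu : MeasurableSet u := by
    rw [hu_def]; split_ifs <;> simp [ht]
  have hgn : Measurable fun ω : ∀ i, X i => g (ω n) := hg.comp (measurable_pi_apply n)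
  rw [withDensity_apply _ hs, ← lintegral_indicator hs,
    lintegral_infinitePi_update μ n (hgn.indicator hs)]
  have key : ∀ ω y, ((s : Set ι).pi t).indicator (fun ω => g (ω n)) (Function.update ω n y) =
      (((s.erase n : Finset ι) : Set ι).pi t).indicator 1 ω * u.indicator g y := by
    intro ω y
    have : Function.update ω n y ∈ (s : Set ι).pi t ↔
        ω ∈ ((s.erase n : Finset ι) : Set ι).pi t ∧ y ∈ u := by
      simp only [Set.mem_pi, Finset.mem_coe, Finset.mem_erase, hu_def]
      constructor
      · intro h
        refine ⟨fun i hi => ?_, ?_⟩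
        · simpa [Function.update_of_ne hi.1] using h i hi.2
        · split_ifs with hn
          · simpa using h n hn
          · trivial
      · rintro ⟨h1, h2⟩ i hi
        by_cases h : i = n
        · subst h; simpa [hi] using h2
        · simpa [Function.update_of_ne h] using h1 i ⟨h, hi⟩
    by_cases h1 : ω ∈ ((s.erase n : Finset ι) : Set ι).pi t <;> by_cases h2 : y ∈ u
    · rw [indicator_of_mem (this.2 ⟨h1, h2⟩), indicator_of_mem h1, indicator_of_mem h2]; simp
    all_goals rw [indicator_of_notMem (fun h => by have := this.1 h; tauto)]
    · rw [indicator_of_notMem h2, mul_zero]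
    all_goals rw [indicator_of_notMem h1, zero_mul]
  simp_rw [key]
  rw [lintegral_congr fun ω => lintegral_const_mul _ (hg.indicator hu),
    lintegral_mul_const _ (measurable_one.indicator hs'), lintegral_indicator_one hs',
    lintegral_indicator hu, ← withDensity_apply _ hu, ← hn,
    Measure.infinitePi_pi _ (fun i _ => ht i),
    Finset.prod_congr rfl (fun i hi => by rw [← hne i (Finset.ne_of_mem_erase hi)] :
      ∀ i ∈ s.erase n, μ i (t i) = ν i (t i))]
  by_cases h : n ∈ s
  · rw [hu_def, if_pos h, mul_comm, Finset.mul_prod_erase s (fun i => ν i (t i)) h]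
  · rw [hu_def, if_neg h, Finset.erase_eq_of_notMem h]; simp

lemma pi_withDensity_eval [Fintype ι] (μ ν : ∀ i, Measure (X i))
    [∀ i, IsProbabilityMeasure (μ i)] [∀ i, IsProbabilityMeasure (ν i)] (n : ι)
    {g : X n → ℝ≥0∞} (hg : Measurable g) (hn : ν n = (μ n).withDensity g)
    (hne : ∀ i, i ≠ n → ν i = μ i) :
    Measure.pi ν = (Measure.pi μ).withDensity fun ω => g (ω n) := by
  rw [← Measure.infinitePi_eq_pi, ← Measure.infinitePi_eq_pi]
  exact infinitePi_withDensity_eval μ ν n hg hn hne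

end ProductMeasure

/-! ### Gamma and exponential laws -/

section Gamma

lemma measurable_gammaPDF (a r : ℝ) : Measurable (gammaPDF a r) :=
  (measurable_gammaPDFReal a r).ennreal_ofReal

lemma lintegral_gammaMeasure (a r : ℝ) {f : ℝ → ℝ≥0∞} (hf : Measurable f) :
    ∫⁻ t, f t ∂gammaMeasure a r = ∫⁻ t, gammaPDF a r t * f t := by
  rw [gammaMeasure, lintegral_withDensity_eq_lintegral_mul _ (measurable_gammaPDF a r) hf]
  rfl

lemma ae_nonneg_gammaMeasure (a r : ℝ) : ∀ᵐ t ∂gammaMeasure a r, 0 ≤ t := by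
  rw [gammaMeasure, ae_withDensity_iff (measurable_gammaPDF a r)]
  refine ae_of_all _ fun t ht => ?_
  by_contra h
  exact ht (gammaPDF_of_neg (not_le.1 h))

lemma ae_pos_gammaMeasure (a r : ℝ) : ∀ᵐ t ∂gammaMeasure a r, 0 < t := by
  have h0 : ∀ᵐ t ∂gammaMeasure a r, t ≠ 0 :=
    (withDensity_absolutelyContinuous _ _).ae_le (Measure.ae_ne volume 0)
  filter_upwards [h0, ae_nonneg_gammaMeasure a r] with t h1 h2 using lt_of_le_of_ne h2 h1.symm

/-- The density of the convolution of a gamma law and an exponential law. -/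
lemma lintegral_gammaPDF_mul_gammaPDF_one {a r : ℝ} (ha : 0 < a) (hr : 0 < r) (t : ℝ) :
    ∫⁻ s, gammaPDF a r s * gammaPDF 1 r (t - s) = gammaPDF (a + 1) r t := by
  rcases lt_or_ge t 0 with ht | ht
  · rw [gammaPDF_of_neg ht, lintegral_eq_zero_iff' (by
      have := measurable_gammaPDF a r
      have := measurable_gammaPDF 1 r
      fun_prop)]
    refine ae_of_all _ fun s => ?_
    rcases lt_or_ge s 0 with hs | hs
    · simp [gammaPDF_of_neg hs]
    · simp [gammaPDF_of_neg (show t - s < 0 by linarith)]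
  -- The two exponentials multiply to exp(-rt), which is free of s; only the integral of s^(a-1)
  -- over [0, t] is left.
  set c : ℝ := r ^ (a + 1) / Real.Gamma a * Real.exp (-(r * t)) with hc
  have hc0 : 0 ≤ c := by positivity
  have h1 : ∀ s, gammaPDF a r s * gammaPDF 1 r (t - s) =
      (Icc 0 t).indicator (fun s => ENNReal.ofReal (c * s ^ (a - 1))) s := by
    intro s
    by_cases hs : s ∈ Icc 0 t
    · rw [indicator_of_mem hs, gammaPDF_of_nonneg hs.1,
        gammaPDF_of_nonneg (show 0 ≤ t - s by linarith [hs.2]), ← ENNReal.ofReal_mul (by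
          have := hs.1
          positivity)]
      congr 1
      have he : Real.exp (-(r * t)) = Real.exp (-(r * s)) * Real.exp (-(r * (t - s))) := by
        rw [← Real.exp_add]; ring_nf
      rw [hc, he, Real.rpow_add hr, Real.Gamma_one, Real.rpow_one, sub_self, Real.rpow_zero]
      ring
    · rw [indicator_of_notMem hs]
      rcases lt_or_ge s 0 with hs' | hs'
      · simp [gammaPDF_of_neg hs']
      · have : t < s := by
          by_contra h
          exact hs ⟨hs', not_lt.1 h⟩
        simp [gammaPDF_of_neg (show t - s < 0 by linarith)]
  simp_rw [h1]
  have hint : IntervalIntegrable (fun s : ℝ => s ^ (a - 1)) volume 0 t :=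
    intervalIntegral.intervalIntegrable_rpow' (by linarith)
  rw [lintegral_indicator measurableSet_Icc, ← ofReal_integral_eq_lintegral_ofReal,
    integral_Icc_eq_integral_Ioc, ← intervalIntegral.integral_of_le ht,
    intervalIntegral.integral_const_mul, integral_rpow (Or.inl (by linarith)),
    gammaPDF_of_nonneg ht]
  · congr 1
    rw [Real.Gamma_add_one ha.ne', sub_add_cancel, Real.zero_rpow ha.ne', hc, add_sub_cancel_right]
    have := (Real.Gamma_pos_of_pos ha).ne'
    field_simp
    ring
  · rw [← IntegrableOn, integrableOn_Icc_iff_integrableOn_Ioc]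
    exact ((intervalIntegrable_iff_integrableOn_Ioc_of_le ht).1 hint).const_mul c
  · refine (ae_restrict_iff' measurableSet_Icc).2 (ae_of_all _ fun s hs => ?_)
    have := hs.1
    positivity

/-- The sum of independent gamma and exponential variables of the same rate is gamma. -/
lemma lintegral_gammaMeasure_add_expMeasure {a r : ℝ} (ha : 0 < a) (hr : 0 < r) {f : ℝ → ℝ≥0∞}
    (hf : Measurable f) :
    ∫⁻ s, ∫⁻ τ, f (s + τ) ∂expMeasure r ∂gammaMeasure a r =
      ∫⁻ t, f t ∂gammaMeasure (a + 1) r := by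
  have hma := measurable_gammaPDF a r
  have hm1 := measurable_gammaPDF 1 r
  have hexp := isProbabilityMeasure_expMeasure hr
  have h1 : ∀ s, ∫⁻ τ, f (s + τ) ∂expMeasure r = ∫⁻ t, gammaPDF 1 r (t - s) * f t := by
    intro s
    rw [expMeasure, lintegral_gammaMeasure 1 r (by fun_prop),
      ← lintegral_add_left_eq_self (fun t => gammaPDF 1 r (t - s) * f t) s]
    simp
  have hmeas : Measurable fun s => ∫⁻ τ, f (s + τ) ∂expMeasure r := by
    refine Measurable.lintegral_prod_right' (f := fun q : ℝ × ℝ => f (q.1 + q.2)) ?_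
    fun_prop
  rw [lintegral_gammaMeasure a r hmeas]
  simp_rw [h1]
  have h2 : ∀ s, gammaPDF a r s * ∫⁻ t, gammaPDF 1 r (t - s) * f t =
      ∫⁻ t, gammaPDF a r s * gammaPDF 1 r (t - s) * f t := by
    intro s
    rw [← lintegral_const_mul _ (by fun_prop)]
    simp_rw [mul_assoc]
  simp_rw [h2]
  rw [lintegral_lintegral_swap (by fun_prop)]
  rw [lintegral_congr fun t => lintegral_mul_const (f t) (by fun_prop)]
  simp_rw [lintegral_gammaPDF_mul_gammaPDF_one ha hr]
  rw [lintegral_gammaMeasure _ r hf]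

/-- Multiplying the density of shape a by t gives a/r times the density of shape a + 1. -/
lemma lintegral_id_gammaMeasure {a r : ℝ} (ha : 0 < a) (hr : 0 < r) :
    ∫⁻ t, ENNReal.ofReal t ∂gammaMeasure a r = ENNReal.ofReal (a / r) := by
  rw [lintegral_gammaMeasure a r (by fun_prop)]
  have h : ∀ t, gammaPDF a r t * ENNReal.ofReal t =
      ENNReal.ofReal (a / r) * gammaPDF (a + 1) r t := by
    intro t
    rcases lt_or_ge t 0 with ht | ht
    · simp [gammaPDF_of_neg ht]
    rw [gammaPDF_of_nonneg ht, gammaPDF_of_nonneg ht, ← ENNReal.ofReal_mul (by positivity),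
      ← ENNReal.ofReal_mul (by positivity)]
    congr 1
    rcases ht.eq_or_lt with rfl | ht
    · simp [ha.ne']
    have := (Real.Gamma_pos_of_pos ha).ne'
    rw [Real.Gamma_add_one ha.ne', Real.rpow_add hr, add_sub_cancel_right,
      Real.rpow_sub_one ht.ne', Real.rpow_one]
    field_simp
  simp_rw [h]
  rw [lintegral_const_mul _ (measurable_gammaPDF _ _),
    lintegral_gammaPDF_eq_one (by linarith) hr, mul_one]

/-- The value of the Laplace transform at 1 is below 1, which will exclude an accumulation of jumps.
-/
lemma lintegral_exp_neg_expMeasure {r : ℝ} (hr : 0 < r) :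
    ∫⁻ t, ENNReal.ofReal (Real.exp (-t)) ∂expMeasure r = ENNReal.ofReal (r / (r + 1)) := by
  rw [expMeasure, lintegral_gammaMeasure 1 r (by fun_prop)]
  have h : ∀ t, gammaPDF 1 r t * ENNReal.ofReal (Real.exp (-t)) =
      ENNReal.ofReal (r / (r + 1)) * gammaPDF 1 (r + 1) t := by
    intro t
    rcases lt_or_ge t 0 with ht | ht
    · simp [gammaPDF_of_neg ht]
    rw [gammaPDF_of_nonneg ht, gammaPDF_of_nonneg ht, ← ENNReal.ofReal_mul (by positivity),
      ← ENNReal.ofReal_mul (by positivity)]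
    congr 1
    have he : Real.exp (-((r + 1) * t)) = Real.exp (-(r * t)) * Real.exp (-t) := by
      rw [← Real.exp_add]; ring_nf
    rw [he]
    simp only [Real.Gamma_one, Real.rpow_one, sub_self, Real.rpow_zero]
    field_simp
  simp_rw [h]
  rw [lintegral_const_mul _ (measurable_gammaPDF _ _),
    lintegral_gammaPDF_eq_one one_pos (by linarith), mul_one]

lemma integrable_remaining_gammaMeasure {a r : ℝ} (ha : 0 < a) (hr : 0 < r) (H : ℝ) :
    Integrable (fun t => max (H - t) 0) (gammaMeasure a r) := by
  have := isProbabilityMeasure_gammaMeasure ha hr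
  refine Integrable.of_bound (by fun_prop) |H| ?_
  filter_upwards [ae_nonneg_gammaMeasure a r] with t ht
  rw [Real.norm_of_nonneg (le_max_right _ _)]
  exact max_le (by linarith [le_abs_self H]) (abs_nonneg _)

lemma lintegral_remaining_gammaMeasure {a r : ℝ} (ha : 0 < a) (hr : 0 < r) (H : ℝ) :
    ∫⁻ t, ENNReal.ofReal (H - t) ∂gammaMeasure a r =
      ENNReal.ofReal (∫ t, max (H - t) 0 ∂gammaMeasure a r) := by
  rw [ofReal_integral_eq_lintegral_ofReal (integrable_remaining_gammaMeasure ha hr H)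
    (ae_of_all _ fun t => le_max_right _ _)]
  simp

/-- Integrate H ≤ (H - t)⁺ + t; the gamma law has mean a/r. -/
lemma le_integral_remaining_gammaMeasure {a r : ℝ} (ha : 0 < a) (hr : 0 < r) {H : ℝ} :
    H - a / r ≤ ∫ t, max (H - t) 0 ∂gammaMeasure a r := by
  have := isProbabilityMeasure_gammaMeasure ha hr
  have hG : 0 ≤ ∫ t, max (H - t) 0 ∂gammaMeasure a r :=
    integral_nonneg fun t => le_max_right _ _
  have h : ENNReal.ofReal H ≤
      ENNReal.ofReal ((∫ t, max (H - t) 0 ∂gammaMeasure a r) + a / r) := by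
    rw [ENNReal.ofReal_add hG (by positivity), ← lintegral_remaining_gammaMeasure ha hr,
      ← lintegral_id_gammaMeasure ha hr, ← lintegral_add_left (by fun_prop)]
    calc ENNReal.ofReal H = ∫⁻ _, ENNReal.ofReal H ∂gammaMeasure a r := by simp
      _ ≤ _ := lintegral_mono fun t => by
        refine le_trans (ENNReal.ofReal_le_ofReal ?_) ENNReal.ofReal_add_le
        linarith
  linarith [(ENNReal.ofReal_le_ofReal_iff (by positivity)).1 h]

end Gamma

/-- Controls are measurable in time for each fixed state; as there are finitely many states, they
may be evaluated at a random one. -/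
lemma Measurable.apply_of_countable {α β ι : Type*} [MeasurableSpace α] [MeasurableSpace β]
    [MeasurableSpace ι] [Countable ι] [MeasurableSingletonClass ι] {X : α → ι} (hX : Measurable X)
    {F : ι → α → β} (hF : ∀ i, Measurable (F i)) : Measurable fun q => F (X q) q := by
  have : Measurable fun p : ι × α => F p.1 p.2 := measurable_from_prod_countable_right hF
  exact this.comp (hX.prodMk measurable_id)

/-! ### Jump paths: dependence on the noise, measurability -/

section Path

variable {S A : ℕ} {π : ControlMap S A} {x : Fin S} {H : ℝ} {ω ω' : Noise S A}

lemma stateSeq_zero : stateSeq π x H ω 0 = x := rfl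

lemma timeSeq_zero : timeSeq π x H ω 0 = 0 := rfl

lemma stateSeq_succ (n : ℕ) :
    stateSeq π x H ω (n + 1) = (ω n (stateSeq π x H ω n) (actionSeq π x H ω n)).2 := rfl

lemma timeSeq_succ (n : ℕ) :
    timeSeq π x H ω (n + 1) =
      timeSeq π x H ω n + (ω n (stateSeq π x H ω n) (actionSeq π x H ω n)).1 := rfl

/-- The path up to the `n`-th jump depends only on the entries of the noise that it uses. -/
lemma jumpPath_congr {n : ℕ}
    (h : ∀ m < n, ω' m (stateSeq π x H ω m) (actionSeq π x H ω m) =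
      ω m (stateSeq π x H ω m) (actionSeq π x H ω m)) :
    jumpPath π x H ω' n = jumpPath π x H ω n := by
  induction n with
  | zero => rfl
  | succ n ih =>
    have ih := ih fun m hm => h m (hm.trans n.lt_succ_self)
    have hn := h n n.lt_succ_self
    simp only [stateSeq, actionSeq, timeSeq] at hn
    simp only [jumpPath, ih, hn]

lemma stateSeq_congr {n : ℕ} (h : jumpPath π x H ω' n = jumpPath π x H ω n) :
    stateSeq π x H ω' n = stateSeq π x H ω n := congrArg Prod.fst h

lemma timeSeq_congr {n : ℕ} (h : jumpPath π x H ω' n = jumpPath π x H ω n) :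
    timeSeq π x H ω' n = timeSeq π x H ω n := congrArg Prod.snd h

lemma actionSeq_congr {n : ℕ} (h : jumpPath π x H ω' n = jumpPath π x H ω n) :
    actionSeq π x H ω' n = actionSeq π x H ω n := by
  rw [actionSeq, actionSeq, stateSeq_congr h, timeSeq_congr h]

lemma monotone_timeSeq (h : ∀ n x a, 0 < (ω n x a).1) : Monotone (timeSeq π x H ω) :=
  monotone_nat_of_le_succ fun n => by
    rw [timeSeq_succ]
    linarith [h n (stateSeq π x H ω n) (actionSeq π x H ω n)]

section Measurability

variable {α : Type*} [MeasurableSpace α] {Q : α → ControlMap S A}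

lemma measurable_action (hQ : ∀ x, Measurable fun q : α × ℝ => Q q.1 x q.2) {β : Type*}
    [MeasurableSpace β] {f : β → α} {X : β → Fin S} {T : β → ℝ} (hf : Measurable f)
    (hX : Measurable X) (hT : Measurable T) (H : ℝ) :
    Measurable fun b => Q (f b) (X b) (max (H - T b) 0) :=
  hX.apply_of_countable (F := fun x b => Q (f b) x (max (H - T b) 0)) fun x =>
    (hQ x).comp (hf.prodMk (by fun_prop))

lemma measurable_noise_apply {β : Type*} [MeasurableSpace β] {f : β → Noise S A} {X : β → Fin S}
    {a : β → Fin A} (hf : Measurable f) (hX : Measurable X) (ha : Measurable a) (n : ℕ) :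
    Measurable fun b => f b n (X b) (a b) :=
  (hX.prodMk ha).apply_of_countable (F := fun (p : Fin S × Fin A) b => f b n p.1 p.2) fun p => by
    fun_prop

/-- The policy is itself a function of past data, so paths must be measurable jointly in a parameter
and the noise. A fixed policy is the case of the parameter space `Unit`. -/
lemma measurable_jumpPath (hQ : ∀ x, Measurable fun q : α × ℝ => Q q.1 x q.2) (x : Fin S) (H : ℝ)
    (n : ℕ) : Measurable fun q : α × Noise S A => jumpPath (Q q.1) x H q.2 n := by
  induction n with
  | zero => exact measurable_const
  | succ n ih =>
    have ha := measurable_action hQ measurable_fst ih.fst ih.snd H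
    have hs := measurable_noise_apply measurable_snd ih.fst ha n
    exact hs.snd.prodMk (ih.snd.add hs.fst)

lemma measurable_stateSeq (hQ : ∀ x, Measurable fun q : α × ℝ => Q q.1 x q.2) (x : Fin S) (H : ℝ)
    (n : ℕ) : Measurable fun q : α × Noise S A => stateSeq (Q q.1) x H q.2 n :=
  (measurable_jumpPath hQ x H n).fst

lemma measurable_timeSeq (hQ : ∀ x, Measurable fun q : α × ℝ => Q q.1 x q.2) (x : Fin S) (H : ℝ)
    (n : ℕ) : Measurable fun q : α × Noise S A => timeSeq (Q q.1) x H q.2 n :=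
  (measurable_jumpPath hQ x H n).snd

lemma measurable_actionSeq (hQ : ∀ x, Measurable fun q : α × ℝ => Q q.1 x q.2) (x : Fin S) (H : ℝ)
    (n : ℕ) : Measurable fun q : α × Noise S A => actionSeq (Q q.1) x H q.2 n :=
  measurable_action hQ measurable_fst (measurable_stateSeq hQ x H n)
    (measurable_timeSeq hQ x H n) H

lemma measurable_observe (hQ : ∀ x, Measurable fun q : α × ℝ => Q q.1 x q.2) (x : Fin S) (H : ℝ) :
    Measurable fun q : α × Noise S A => observe (Q q.1) x H q.2 := by
  rw [measurable_pi_iff]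
  intro n
  have ht := measurable_timeSeq hQ x H n
  have ht' := measurable_timeSeq hQ x H (n + 1)
  refine Measurable.ite (measurableSet_le ht measurable_const) ?_ measurable_const
  exact measurable_inl.comp ((measurable_stateSeq hQ x H n).prodMk
    ((measurable_actionSeq hQ x H n).prodMk ((ht'.min measurable_const).sub ht)))

lemma measurable_control_of_const (hπ : ∀ x, Measurable (π x)) (x : Fin S) :
    Measurable fun q : Unit × ℝ => (fun _ : Unit => π) q.1 x q.2 :=
  (hπ x).comp measurable_snd

lemma measurable_jumpPath_noise (hπ : ∀ x, Measurable (π x)) (x : Fin S) (H : ℝ) (n : ℕ) :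
    Measurable fun ω : Noise S A => jumpPath π x H ω n :=
  (measurable_jumpPath (Q := fun _ : Unit => π) (measurable_control_of_const hπ) x H n).comp
    (measurable_prodMk_left (x := ()))

lemma measurable_stateSeq_noise (hπ : ∀ x, Measurable (π x)) (x : Fin S) (H : ℝ) (n : ℕ) :
    Measurable fun ω : Noise S A => stateSeq π x H ω n :=
  (measurable_stateSeq (Q := fun _ : Unit => π) (measurable_control_of_const hπ) x H n).comp
    (measurable_prodMk_left (x := ()))

lemma measurable_timeSeq_noise (hπ : ∀ x, Measurable (π x)) (x : Fin S) (H : ℝ) (n : ℕ) :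
    Measurable fun ω : Noise S A => timeSeq π x H ω n :=
  (measurable_timeSeq (Q := fun _ : Unit => π) (measurable_control_of_const hπ) x H n).comp
    (measurable_prodMk_left (x := ()))

lemma measurable_actionSeq_noise (hπ : ∀ x, Measurable (π x)) (x : Fin S) (H : ℝ) (n : ℕ) :
    Measurable fun ω : Noise S A => actionSeq π x H ω n :=
  (measurable_actionSeq (Q := fun _ : Unit => π) (measurable_control_of_const hπ) x H n).comp
    (measurable_prodMk_left (x := ()))

lemma measurable_observe_noise (hπ : ∀ x, Measurable (π x)) (x : Fin S) (H : ℝ) :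
    Measurable fun ω : Noise S A => observe π x H ω :=
  (measurable_observe (Q := fun _ : Unit => π) (measurable_control_of_const hπ) x H).comp
    (measurable_prodMk_left (x := ()))

end Measurability

end Path

/-! ### Markov property and law of the jump times -/

namespace CTMDP

variable {S A : ℕ} (M : CTMDP S A)

instance : IsProbabilityMeasure M.noiseLaw := by
  unfold noiseLaw; infer_instance

lemma lintegral_entry (x : Fin S) (a : Fin A) {f : ℝ × Fin S → ℝ≥0∞} (hf : Measurable f) :
    ∫⁻ y, f (y x a) ∂(Measure.pi fun x => Measure.pi fun a => M.stepLaw x a) =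
      ∫⁻ z, f z ∂M.stepLaw x a := by
  rw [← (measurePreserving_eval (fun a => M.stepLaw x a) a).lintegral_comp hf]
  exact (measurePreserving_eval (fun x => Measure.pi fun a => M.stepLaw x a) x).lintegral_comp
    (hf.comp (measurable_pi_apply a))

lemma lintegral_stepLaw (x : Fin S) (a : Fin A) {f : ℝ × Fin S → ℝ≥0∞} (hf : Measurable f) :
    ∫⁻ z, f z ∂M.stepLaw x a =
      ∫⁻ τ, ∑ y, M.p x a y * f (τ, y) ∂expMeasure (M.rate x a) := by
  have := isProbabilityMeasure_expMeasure (M.rate_pos x a)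
  rw [stepLaw, lintegral_prod _ hf.aemeasurable]
  refine lintegral_congr fun τ => ?_
  rw [lintegral_fintype]
  refine Finset.sum_congr rfl fun y _ => ?_
  rw [PMF.toMeasure_apply_singleton _ _ (measurableSet_singleton y), mul_comm]

/-- The Markov property: given the first `n` jumps, the next holding time and the next state are
distributed according to the step law of the current state-action pair. -/
lemma lintegral_noiseLaw_step {π : ControlMap S A} (hπ : ∀ x, Measurable (π x)) (x : Fin S)
    (H : ℝ) (n : ℕ) {Ψ : (Fin S × ℝ) × (ℝ × Fin S) → ℝ≥0∞} (hΨ : Measurable Ψ) :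
    ∫⁻ ω, Ψ (jumpPath π x H ω n, ω n (stateSeq π x H ω n) (actionSeq π x H ω n)) ∂M.noiseLaw =
      ∫⁻ ω, ∫⁻ z, Ψ (jumpPath π x H ω n, z)
        ∂M.stepLaw (stateSeq π x H ω n) (actionSeq π x H ω n) ∂M.noiseLaw := by
  have hj := measurable_jumpPath_noise hπ x H n
  have hs := measurable_stateSeq_noise hπ x H n
  have ha := measurable_actionSeq_noise hπ x H n
  have hm : Measurable fun ω : Noise S A =>
      Ψ (jumpPath π x H ω n, ω n (stateSeq π x H ω n) (actionSeq π x H ω n)) :=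
    hΨ.comp (hj.prodMk (measurable_noise_apply measurable_id hs ha n))
  conv_lhs => rw [noiseLaw, lintegral_infinitePi_update _ n hm]
  refine lintegral_congr fun ω => ?_
  -- The first `n` jumps use steps before `n` only, so resampling step `n` leaves them alone and
  -- makes it independent of them.
  have hu : ∀ y, jumpPath π x H (Function.update ω n y) n = jumpPath π x H ω n := fun y =>
    jumpPath_congr fun m hm => by rw [Function.update_of_ne hm.ne]
  simp_rw [stateSeq_congr (hu _), actionSeq_congr (hu _), hu, Function.update_self]
  exact M.lintegral_entry _ _ (f := fun z => Ψ (jumpPath π x H ω n, z)) (by fun_prop)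

lemma ae_noiseLaw_entry {P : Fin S → Fin A → ℝ × Fin S → Prop}
    (h : ∀ x a, ∀ᵐ z ∂M.stepLaw x a, P x a z) : ∀ᵐ ω ∂M.noiseLaw, ∀ n x a, P x a (ω n x a) := by
  simp_rw [ae_all_iff]
  intro n x a
  have h1 := (measurePreserving_eval (fun a => M.stepLaw x a) a).quasiMeasurePreserving.ae (h x a)
  have h2 := (measurePreserving_eval
    (fun x => Measure.pi fun a => M.stepLaw x a) x).quasiMeasurePreserving.ae h1
  exact (measurePreserving_eval_infinitePi (fun _ : ℕ => Measure.pi fun x => Measure.pi fun a =>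
    M.stepLaw x a) n).quasiMeasurePreserving.ae h2

/-- Noise with positive holding times and jumps along the support of the transition
probabilities. -/
def Regular (ω : Noise S A) : Prop := ∀ n x a, 0 < (ω n x a).1 ∧ M.p x a (ω n x a).2 ≠ 0

lemma ae_regular : ∀ᵐ ω ∂M.noiseLaw, M.Regular ω := by
  refine M.ae_noiseLaw_entry (P := fun x a z => 0 < z.1 ∧ M.p x a z.2 ≠ 0) fun x a => ?_
  have := isProbabilityMeasure_expMeasure (M.rate_pos x a)
  have h1 : ∀ᵐ z ∂M.stepLaw x a, 0 < z.1 :=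
    Measure.quasiMeasurePreserving_fst.ae (ae_pos_gammaMeasure 1 _)
  have h2 : ∀ᵐ y ∂(M.p x a).toMeasure, M.p x a y ≠ 0 := by
    rw [ae_iff, PMF.toMeasure_apply_eq_zero_iff _ (.of_discrete), Set.disjoint_left]
    intro y hy
    simpa [PMF.mem_support_iff] using hy
  filter_upwards [h1, Measure.quasiMeasurePreserving_snd.ae h2] with z h1 h2 using ⟨h1, h2⟩

section ConstantRate

variable {M} {r : ℝ}

lemma lintegral_stepLaw_fst (x : Fin S) (a : Fin A) {f : ℝ → ℝ≥0∞} (hf : Measurable f) :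
    ∫⁻ z, f z.1 ∂M.stepLaw x a = ∫⁻ τ, f τ ∂expMeasure (M.rate x a) := by
  have := isProbabilityMeasure_expMeasure (M.rate_pos x a)
  exact measurePreserving_fst.lintegral_comp hf

lemma lintegral_timeSeq_succ (hM : ∀ x a, M.rate x a = r) {π : ControlMap S A}
    (hπ : ∀ x, Measurable (π x)) (x : Fin S) (H : ℝ) (n : ℕ) {f : ℝ → ℝ≥0∞} (hf : Measurable f) :
    ∫⁻ ω, f (timeSeq π x H ω (n + 1)) ∂M.noiseLaw =
      ∫⁻ ω, ∫⁻ τ, f (timeSeq π x H ω n + τ) ∂expMeasure r ∂M.noiseLaw := by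
  refine (M.lintegral_noiseLaw_step hπ x H n (Ψ := fun q => f (q.1.2 + q.2.1))
    (by fun_prop)).trans (lintegral_congr fun ω => ?_)
  rw [lintegral_stepLaw_fst _ _ (f := fun τ => f ((jumpPath π x H ω n).2 + τ)) (by fun_prop), hM]
  rfl

/-- A common rate makes each holding time independent of the past, whatever actions the policy
chooses: the jump times are sums of i.i.d. exponentials. -/
lemma lintegral_timeSeq_eq_gamma (hM : ∀ x a, M.rate x a = r) (hr : 0 < r) {π : ControlMap S A}
    (hπ : ∀ x, Measurable (π x)) (x : Fin S) (H : ℝ) (n : ℕ) {f : ℝ → ℝ≥0∞} (hf : Measurable f) :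
    ∫⁻ ω, f (timeSeq π x H ω (n + 1)) ∂M.noiseLaw = ∫⁻ t, f t ∂gammaMeasure ((n + 1 : ℕ) : ℝ) r := by
  have hexp := isProbabilityMeasure_expMeasure hr
  induction n generalizing f with
  | zero =>
    rw [lintegral_timeSeq_succ hM hπ x H 0 hf]
    simp [timeSeq_zero, expMeasure]
  | succ n ih =>
    rw [lintegral_timeSeq_succ hM hπ x H (n + 1) hf,
      ih (f := fun t => ∫⁻ τ, f (t + τ) ∂expMeasure r)
        (Measurable.lintegral_prod_right' (f := fun q : ℝ × ℝ => f (q.1 + q.2)) (by fun_prop)),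
      lintegral_gammaMeasure_add_expMeasure (by positivity) hr hf]
    push_cast
    rfl

/-- With constant holding-time rates the jump times do not accumulate. -/
lemma ae_tendsto_timeSeq (hM : ∀ x a, M.rate x a = r) (hr : 0 < r) {π : ControlMap S A}
    (hπ : ∀ x, Measurable (π x)) (x : Fin S) (H : ℝ) :
    ∀ᵐ ω ∂M.noiseLaw, Filter.Tendsto (timeSeq π x H ω) Filter.atTop Filter.atTop := by
  -- The mean of exp(-tₙ) is (r / (r + 1))ⁿ. This is summable, so almost surely exp(-tₙ) tends to 0.
  set f : ℝ → ℝ≥0∞ := fun t => ENNReal.ofReal (Real.exp (-t)) with hf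
  have hfm : Measurable f := by fun_prop
  have hft : ∀ n, Measurable fun ω : Noise S A => f (timeSeq π x H ω n) := fun n =>
    hfm.comp (measurable_timeSeq_noise hπ x H n)
  set q : ℝ≥0∞ := ENNReal.ofReal (r / (r + 1)) with hq
  have hmean : ∀ n, ∫⁻ ω, f (timeSeq π x H ω n) ∂M.noiseLaw = q ^ n := by
    intro n
    induction n with
    | zero => simp [timeSeq_zero, hf]
    | succ n ih =>
      have h : ∀ t, ∫⁻ τ, f (t + τ) ∂expMeasure r = f t * q := fun t => by
        rw [hq, ← lintegral_exp_neg_expMeasure hr, ← lintegral_const_mul _ (by fun_prop)]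
        refine lintegral_congr fun τ => ?_
        rw [hf, ← ENNReal.ofReal_mul (by positivity), ← Real.exp_add]
        ring_nf
      rw [lintegral_timeSeq_succ hM hπ x H n hfm, lintegral_congr fun ω => h _,
        lintegral_mul_const _ (hft n), ih, pow_succ]
  have hsum : ∫⁻ ω, ∑' n, f (timeSeq π x H ω n) ∂M.noiseLaw ≠ ∞ := by
    rw [lintegral_tsum fun n => (hft n).aemeasurable]
    simp_rw [hmean]
    rw [ENNReal.tsum_geometric]
    have : q < 1 := by
      rw [hq, ← ENNReal.ofReal_one]
      exact (ENNReal.ofReal_lt_ofReal_iff one_pos).2 ((div_lt_one (by linarith)).2 (by linarith))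
    exact ENNReal.inv_ne_top.2 (tsub_pos_of_lt this).ne'
  have hsm : Measurable fun ω : Noise S A => ∑' n, f (timeSeq π x H ω n) :=
    Measurable.tsum fun n => hft n
  filter_upwards [ae_lt_top hsm hsum] with ω hω
  have h0 := ENNReal.tendsto_atTop_zero_of_tsum_ne_top hω.ne
  have h1 : Filter.Tendsto (fun n => Real.exp (-timeSeq π x H ω n)) Filter.atTop (nhds 0) := by
    have := (ENNReal.tendsto_toReal ENNReal.zero_ne_top).comp h0
    refine Filter.Tendsto.congr (fun n => ?_) this
    simp [hf, ENNReal.toReal_ofReal (Real.exp_pos _).le]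
  have h2 := Real.tendsto_exp_comp_nhds_zero.1 h1
  exact Filter.tendsto_neg_atBot_iff.1 h2

end ConstantRate

end CTMDP

/-! ### The tree-shaped model and its paths -/

/-- The nodes of the `n`-th level of the complete `A`-ary tree, numbered level by level from `0`,
are those from `levelStart A n` to `levelStart A (n + 1) - 1`. -/
def levelStart (A n : ℕ) : ℕ := ∑ i ∈ Finset.range n, A ^ i

lemma levelStart_succ (A n : ℕ) : levelStart A (n + 1) = A * levelStart A n + 1 :=
  geom_sum_succ

lemma levelStart_succ' (A n : ℕ) : levelStart A (n + 1) = levelStart A n + A ^ n :=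
  Finset.sum_range_succ _ n

lemma monotone_levelStart (A : ℕ) : Monotone (levelStart A) :=
  monotone_nat_of_le_succ fun n => by rw [levelStart_succ']; exact Nat.le_add_right _ _

namespace TreeModel

variable {S A e : ℕ} (hS : S = levelStart A (e + 1) + 2)

/-- The rewarding absorbing state. -/
def good : Fin S := ⟨levelStart A (e + 1) + 1, by omega⟩

/-- The absorbing state without reward. -/
def bad : Fin S := ⟨levelStart A (e + 1), by omega⟩

/-- The root of the tree. -/
def root : Fin S := ⟨0, by omega⟩

lemma good_ne_bad : good hS ≠ bad hS := by simp [good, bad]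

-- The children of node x are numbered A x + 1, …, A x + A. The leaves form level `e`, so inner
-- nodes have all their children inside the tree.
include hS in
lemma child_lt {x : Fin S} (h : x.1 < levelStart A e) (a : Fin A) : A * x.1 + a.1 + 1 < S := by
  have h1 := levelStart_succ A e
  have h2 : A * (x.1 + 1) ≤ A * levelStart A e := Nat.mul_le_mul_left _ h
  have := a.2
  rw [Nat.mul_add] at h2
  omega

/-- A lottery between the two absorbing states. -/
noncomputable def lottery (b : Icc (0 : ℝ) (1 / 2)) : PMF (Fin S) :=
  PMF.ofFintype (fun y => if y = good hS then ENNReal.ofReal (1 / 2 + b)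
    else if y = bad hS then ENNReal.ofReal (1 / 2 - b) else 0) (by
    have hb := b.2
    rw [Finset.sum_ite, Finset.sum_ite, Finset.sum_const_zero, add_zero, Finset.filter_eq',
      if_pos (Finset.mem_univ _), Finset.sum_const, Finset.sum_const, Finset.filter_filter]
    have : (Finset.univ.filter fun y : Fin S => y ≠ good hS ∧ y = bad hS) = {bad hS} := by
      ext y
      simp only [Finset.mem_filter, Finset.mem_univ, true_and, Finset.mem_singleton]
      exact ⟨fun h => h.2, fun h => ⟨h ▸ (good_ne_bad hS).symm, h⟩⟩
    rw [this]
    simp only [Finset.card_singleton, one_smul]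
    rw [← ENNReal.ofReal_add (by linarith [hb.1]) (by linarith [hb.2])]
    norm_num)

lemma lottery_apply (b : Icc (0 : ℝ) (1 / 2)) (y : Fin S) :
    lottery hS b y = if y = good hS then ENNReal.ofReal (1 / 2 + b)
      else if y = bad hS then ENNReal.ofReal (1 / 2 - b) else 0 := rfl

/-- At inner nodes of the tree, action `a` leads to the `a`-th child; at leaves every action leads
to a lottery between the two absorbing states. -/
noncomputable def trans (b : Fin S → Fin A → Icc (0 : ℝ) (1 / 2)) (x : Fin S) (a : Fin A) :
    PMF (Fin S) :=
  if h : x.1 < levelStart A e then PMF.pure ⟨A * x.1 + a.1 + 1, child_lt hS h a⟩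
  else if x.1 < levelStart A (e + 1) then lottery hS (b x a) else PMF.pure x

/-- The tree-shaped decision process in which all holding times have rate `rate`, and in which
action `a` in the leaf `x` leads to the good state with probability `1 / 2 + b x a`. -/
noncomputable def model {rate : ℝ} (hr : 0 < rate) (b : Fin S → Fin A → Icc (0 : ℝ) (1 / 2)) :
    CTMDP S A where
  r x _ := if x = good hS then 1 else 0
  rate _ _ := rate
  p := trans hS b
  x₀ := root hS
  rate_pos _ _ := hr
  jump_or_absorbing x := by
    by_cases h1 : x.1 < levelStart A e
    · left
      intro a
      have hA : 0 < A := a.pos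
      rw [trans, dif_pos h1, PMF.pure_apply, if_neg]
      rw [Fin.ext_iff]
      have : x.1 ≤ A * x.1 := Nat.le_mul_of_pos_left _ hA
      simp only
      omega
    by_cases h2 : x.1 < levelStart A (e + 1)
    · left
      intro a
      rw [trans, dif_neg h1, if_pos h2, lottery_apply, if_neg, if_neg]
      · rw [bad, Fin.ext_iff]; simp only; omega
      · rw [good, Fin.ext_iff]; simp only; omega
    · right
      intro a
      rw [trans, dif_neg h1, if_neg h2]
      simp

/-- The noises that respect the tree structure. -/
def Compatible (ω : Noise S A) : Prop :=
  ∀ n x a, 0 < (ω n x a).1 ∧ (x.1 < levelStart A e → (ω n x a).2.1 = A * x.1 + a.1 + 1) ∧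
    (levelStart A e ≤ x.1 → x.1 < levelStart A (e + 1) →
      (ω n x a).2 = good hS ∨ (ω n x a).2 = bad hS) ∧
    (levelStart A (e + 1) ≤ x.1 → (ω n x a).2 = x)

lemma ae_compatible {rate : ℝ} (hr : 0 < rate) (b : Fin S → Fin A → Icc (0 : ℝ) (1 / 2)) :
    ∀ᵐ ω ∂(model hS hr b).noiseLaw, Compatible hS ω := by
  filter_upwards [(model hS hr b).ae_regular] with ω hω n x a
  obtain ⟨h1, h2⟩ := hω n x a
  have hmono := monotone_levelStart A e.le_succ
  refine ⟨h1, fun h => ?_, fun h h' => ?_, fun h => ?_⟩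
  · simp only [model, trans, dif_pos h, PMF.pure_apply] at h2
    by_contra hne
    exact h2 (if_neg fun h => hne (Fin.ext_iff.1 h))
  · simp only [model, trans, dif_neg (not_lt.2 h), if_pos h', lottery_apply] at h2
    by_contra hne
    rw [not_or] at hne
    rw [if_neg hne.1, if_neg hne.2] at h2
    exact h2 rfl
  · simp only [model, trans, dif_neg (not_lt.2 (hmono.trans h)), if_neg (not_lt.2 h),
      PMF.pure_apply] at h2
    by_contra hne
    exact h2 (if_neg hne)

section Path

variable {hS} {π : ControlMap S A} {H : ℝ} {ω : Noise S A}

lemma Compatible.time_pos (hω : Compatible hS ω) : ∀ n x a, 0 < (ω n x a).1 :=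
  fun n x a => (hω n x a).1

lemma Compatible.stateSeq_mem_level (hω : Compatible hS ω) {n : ℕ} (hn : n ≤ e) :
    levelStart A n ≤ (stateSeq π (root hS) H ω n).1 ∧
      (stateSeq π (root hS) H ω n).1 < levelStart A (n + 1) := by
  induction n with
  | zero => simp [stateSeq_zero, root, levelStart]
  | succ n ih =>
    obtain ⟨h1, h2⟩ := ih (by omega)
    set x := stateSeq π (root hS) H ω n
    set a := actionSeq π (root hS) H ω n
    have h3 := (hω n x a).2.1 (h2.trans_le (monotone_levelStart A hn))
    rw [stateSeq_succ, h3, levelStart_succ A (n + 1), levelStart_succ A n]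
    have h4 := Nat.mul_le_mul_left A h1
    have h5 : A * (x.1 + 1) ≤ A * levelStart A (n + 1) := Nat.mul_le_mul_left _ h2
    rw [Nat.mul_add, levelStart_succ] at h5
    have := a.2
    omega

lemma Compatible.stateSeq_succ (hω : Compatible hS ω) {n : ℕ} (hn : n < e) :
    (stateSeq π (root hS) H ω (n + 1)).1 =
      A * (stateSeq π (root hS) H ω n).1 + (actionSeq π (root hS) H ω n).1 + 1 :=
  (hω n _ _).2.1 ((hω.stateSeq_mem_level hn.le).2.trans_le (monotone_levelStart A hn))

lemma Compatible.stateSeq_absorbed (hω : Compatible hS ω) {n : ℕ} (hn : e + 1 ≤ n) :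
    stateSeq π (root hS) H ω n = stateSeq π (root hS) H ω (e + 1) ∧
      (stateSeq π (root hS) H ω (e + 1) = good hS ∨
        stateSeq π (root hS) H ω (e + 1) = bad hS) := by
  induction n, hn using Nat.le_induction with
  | base =>
    obtain ⟨h1, h2⟩ := hω.stateSeq_mem_level (π := π) (H := H) le_rfl
    exact ⟨rfl, (hω e _ _).2.2.1 h1 h2⟩
  | succ n hn ih =>
    refine ⟨?_, ih.2⟩
    rw [_root_.stateSeq_succ, (hω n _ _).2.2.2, ih.1]
    rw [ih.1]
    rcases ih.2 with h | h <;> simp [h, good, bad]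

/-- A leaf is visited only after the `e`-th jump. -/
lemma Compatible.eq_of_stateSeq_leaf (hω : Compatible hS ω) {n : ℕ}
    (h1 : levelStart A e ≤ (stateSeq π (root hS) H ω n).1)
    (h2 : (stateSeq π (root hS) H ω n).1 < levelStart A (e + 1)) : n = e := by
  rcases lt_trichotomy n e with h | h | h
  · have := (hω.stateSeq_mem_level (π := π) (H := H) h.le).2
    have := monotone_levelStart A (show n + 1 ≤ e from h)
    omega
  · exact h
  · obtain ⟨h3, h4⟩ := hω.stateSeq_absorbed (π := π) (H := H) (show e + 1 ≤ n from h)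
    rw [h3] at h2
    rcases h4 with h4 | h4 <;> simp [h4, good, bad] at h2

lemma Compatible.stateSeq_eq_good_iff (hω : Compatible hS ω) (n : ℕ) :
    stateSeq π (root hS) H ω n = good hS ↔
      e + 1 ≤ n ∧ stateSeq π (root hS) H ω (e + 1) = good hS := by
  constructor
  · intro h
    have hn : e + 1 ≤ n := by
      by_contra hn
      have h1 := (hω.stateSeq_mem_level (π := π) (H := H) (show n ≤ e by omega)).2
      have h2 := monotone_levelStart A (show n + 1 ≤ e + 1 by omega)
      rw [h] at h1
      simp only [good] at h1
      omega
    exact ⟨hn, (hω.stateSeq_absorbed hn).1 ▸ h⟩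
  · rintro ⟨hn, h⟩
    rw [(hω.stateSeq_absorbed hn).1, h]

/-- The good state is entered at jump `e + 1` or never, and it is never left. Since the jump times
increase to infinity, exactly one term of the series is active at time `u`. -/
lemma Compatible.rewardRate_eq {rate : ℝ} (hr : 0 < rate) (b : Fin S → Fin A → Icc (0 : ℝ) (1 / 2))
    (hω : Compatible hS ω)
    (ht : Filter.Tendsto (timeSeq π (root hS) H ω) Filter.atTop Filter.atTop) {u : ℝ}
    (hu : 0 ≤ u) :
    rewardRate π (root hS) H ω (model hS hr b).r u =
      (Ici (timeSeq π (root hS) H ω (e + 1))).indicator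
        (fun _ => if stateSeq π (root hS) H ω (e + 1) = good hS then 1 else 0) u := by
  have hmono := monotone_timeSeq (π := π) (x := root hS) (H := H) hω.time_pos
  have hex : ∃ n, u < timeSeq π (root hS) H ω (n + 1) := by
    obtain ⟨n, hn⟩ := (ht.eventually_gt_atTop u).exists
    exact ⟨n, hn.trans_le (hmono n.le_succ)⟩
  classical
  set n := Nat.find hex with hn_def
  have hn1 : u < timeSeq π (root hS) H ω (n + 1) := Nat.find_spec hex
  have hn0 : timeSeq π (root hS) H ω n ≤ u := by
    rcases Nat.eq_zero_or_pos n with h | h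
    · rw [h, timeSeq_zero]; exact hu
    · have := Nat.find_min hex (show n - 1 < n by omega)
      rw [not_lt, Nat.sub_add_cancel h] at this
      exact this
  rw [rewardRate, tsum_eq_single n, indicator_of_mem (show u ∈ Ico _ _ from ⟨hn0, hn1⟩)]
  · simp only [model, hω.stateSeq_eq_good_iff n]
    by_cases h : e + 1 ≤ n
    · rw [indicator_of_mem (show u ∈ Ici _ from (hmono h).trans hn0)]
      simp [h]
    · rw [indicator_of_notMem, if_neg (fun h' => h h'.1)]
      simp only [mem_Ici, not_le]
      exact hn1.trans_le (hmono (by omega))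
  · intro m hm
    refine indicator_of_notMem ?_ _
    rintro ⟨h1, h2⟩
    rcases lt_or_gt_of_ne hm with h | h
    · exact absurd (h2.trans_le (hmono (show m + 1 ≤ n from h))) (not_lt.2 hn0)
    · exact absurd (hn1.trans_le (hmono (show n + 1 ≤ m from h))) (not_lt.2 h1)

lemma Compatible.integral_rewardRate {rate : ℝ} (hr : 0 < rate)
    (b : Fin S → Fin A → Icc (0 : ℝ) (1 / 2)) (hH : 0 ≤ H) (hω : Compatible hS ω)
    (ht : Filter.Tendsto (timeSeq π (root hS) H ω) Filter.atTop Filter.atTop) :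
    ∫ u in (0 : ℝ)..H, rewardRate π (root hS) H ω (model hS hr b).r u =
      if stateSeq π (root hS) H ω (e + 1) = good hS then
        max (H - timeSeq π (root hS) H ω (e + 1)) 0 else 0 := by
  set T := timeSeq π (root hS) H ω (e + 1) with hT
  -- Positivity makes the half-open interval `Ioc 0 H` meet `Ici T` in the closed interval `Icc T
  -- H`.
  have hT0 : 0 < T := by
    rw [hT, timeSeq_succ]
    have := monotone_timeSeq (π := π) (x := root hS) (H := H) hω.time_pos e.zero_le
    rw [timeSeq_zero] at this
    linarith [hω.time_pos e (stateSeq π (root hS) H ω e) (actionSeq π (root hS) H ω e)]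
  rw [intervalIntegral.integral_of_le hH, setIntegral_congr_fun measurableSet_Ioc
    fun u hu => hω.rewardRate_eq hr b ht (le_of_lt hu.1), setIntegral_indicator measurableSet_Ici]
  have : Ioc 0 H ∩ Ici T = Icc T H := by
    ext u
    simp only [mem_inter_iff, mem_Ioc, mem_Ici, mem_Icc]
    exact ⟨fun h => ⟨h.2, h.1.2⟩, fun h => ⟨⟨hT0.trans_le h.1, h.2⟩, h.1⟩⟩
  rw [this, setIntegral_const, Real.volume_real_Icc]
  simp

end Path

end TreeModel

/-! ### Reachability of the leaves, hit weights and values -/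

namespace TreeModel

variable {S A e : ℕ} {hS : S = levelStart A (e + 1) + 2} {rate : ℝ} {hr : 0 < rate}

section Routing

/-- The controller that plays `ρ x` in state `x` at all times. -/
def stationary (ρ : Fin S → Fin A) : ControlMap S A := fun x _ => ρ x

lemma stateSeq_stationary_congr {ρ ρ' : Fin S → Fin A} {n : ℕ} (hn : n ≤ e)
    (h : ∀ x : Fin S, x.1 < levelStart A n → ρ' x = ρ x) {H : ℝ} {ω : Noise S A}
    (hω : Compatible hS ω) {k : ℕ} (hk : k ≤ n) :
    stateSeq (stationary ρ') (root hS) H ω k = stateSeq (stationary ρ) (root hS) H ω k := by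
  induction k with
  | zero => rfl
  | succ k ih =>
    have ih := ih (by omega)
    rw [Fin.ext_iff, hω.stateSeq_succ (by omega), hω.stateSeq_succ (by omega), ih, actionSeq,
      actionSeq, stationary, stationary, ih, h]
    exact (hω.stateSeq_mem_level (by omega)).2.trans_le (monotone_levelStart A hk)

/-- Every node of the tree is reached by a stationary policy. -/
lemma exists_stationary (n : ℕ) (hn : n ≤ e) (y : Fin S) (h1 : levelStart A n ≤ y.1)
    (h2 : y.1 < levelStart A (n + 1)) (a : Fin A) :
    ∃ ρ : Fin S → Fin A, ρ y = a ∧ ∀ H ω, Compatible hS ω →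
      stateSeq (stationary ρ) (root hS) H ω n = y := by
  induction n generalizing y a with
  | zero =>
    refine ⟨fun _ => a, rfl, fun H ω _ => ?_⟩
    rw [stateSeq_zero, Fin.ext_iff]
    simp [levelStart] at h2
    simp [root, h2]
  | succ n ih =>
    have hA : 0 < A := a.pos
    rw [levelStart_succ] at h1 h2
    have hdm := Nat.div_add_mod (y.1 - 1) A
    have hz1 : levelStart A n ≤ (y.1 - 1) / A := by
      rw [Nat.le_div_iff_mul_le hA, mul_comm]; omega
    have hz2 : (y.1 - 1) / A < levelStart A (n + 1) := by
      rw [Nat.div_lt_iff_lt_mul hA, mul_comm]; omega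
    have hz3 : (y.1 - 1) / A < S := by
      have := monotone_levelStart A (show n + 1 ≤ e + 1 by omega)
      omega
    -- The parent of `y` is (y - 1) / A, and (y - 1) % A is the action leading from it to `y`.
    -- Prescribing the action at `y` afterwards does not disturb the route, which runs through
    -- earlier levels.
    obtain ⟨ρ, hρ, hreach⟩ := ih (by omega) ⟨(y.1 - 1) / A, hz3⟩ hz1 hz2
      ⟨(y.1 - 1) % A, Nat.mod_lt _ hA⟩
    refine ⟨Function.update ρ y a, Function.update_self _ _ _, fun H ω hω => ?_⟩
    have hne : ∀ x : Fin S, x.1 < levelStart A (n + 1) → Function.update ρ y a x = ρ x := by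
      intro x hx
      refine Function.update_of_ne ?_ _ _
      rintro rfl
      rw [levelStart_succ] at hx
      omega
    rw [stateSeq_stationary_congr hn hne hω le_rfl, Fin.ext_iff, hω.stateSeq_succ (by omega),
      actionSeq, stationary, hreach H ω hω, hρ]
    simp only
    omega

end Routing

section Value

variable {b : Fin S → Fin A → Icc (0 : ℝ) (1 / 2)} {π : ControlMap S A} {H : ℝ}

/-- The gain is the remaining time at jump `e + 1` if that jump succeeds. Given the first `e` jumps,
success is independent of the holding time and has probability 1/2 plus the bias of the pair played.
-/
lemma ofReal_value (hπ : ∀ x, Measurable (π x)) (hH : 0 ≤ H) :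
    0 ≤ (model hS hr b).value H π (root hS) ∧
    ENNReal.ofReal ((model hS hr b).value H π (root hS)) =
      ∫⁻ ω, ENNReal.ofReal (1 / 2 + b (stateSeq π (root hS) H ω e) (actionSeq π (root hS) H ω e)) *
        ∫⁻ τ, ENNReal.ofReal (H - (timeSeq π (root hS) H ω e + τ)) ∂expMeasure rate
        ∂(model hS hr b).noiseLaw := by
  set M := model hS hr b
  have hs := measurable_stateSeq_noise hπ (root hS) H (e + 1)
  have ht := measurable_timeSeq_noise hπ (root hS) H (e + 1)
  set F : Noise S A → ℝ := fun ω => if stateSeq π (root hS) H ω (e + 1) = good hS then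
    max (H - timeSeq π (root hS) H ω (e + 1)) 0 else 0 with hF
  have hFm : Measurable F :=
    Measurable.ite (hs (measurableSet_singleton _)) (by fun_prop) measurable_const
  have hF0 : ∀ ω, 0 ≤ F ω := fun ω => by
    simp only [hF]; split_ifs <;> simp
  have hcomp := ae_compatible (hS := hS) hr b
  have htend := M.ae_tendsto_timeSeq (r := rate) (fun _ _ => rfl) hr hπ (root hS) H
  have hval : M.value H π (root hS) = ∫ ω, F ω ∂M.noiseLaw := by
    refine integral_congr_ae ?_
    filter_upwards [hcomp, htend] with ω h1 h2 using h1.integral_rewardRate hr b hH h2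
  have hint : Integrable F M.noiseLaw := by
    refine Integrable.of_bound hFm.aestronglyMeasurable H ?_
    filter_upwards [hcomp] with ω hω
    rw [Real.norm_of_nonneg (hF0 ω)]
    simp only [hF]
    split_ifs
    · have := monotone_timeSeq (π := π) (x := root hS) (H := H) hω.time_pos (e + 1).zero_le
      rw [timeSeq_zero] at this
      exact max_le (by linarith) hH
    · exact hH
  refine ⟨hval ▸ integral_nonneg hF0, ?_⟩
  rw [hval, ofReal_integral_eq_lintegral_ofReal hint (ae_of_all _ hF0)]
  have hΨ : Measurable fun q : (Fin S × ℝ) × (ℝ × Fin S) =>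
      if q.2.2 = good hS then ENNReal.ofReal (H - (q.1.2 + q.2.1)) else 0 :=
    Measurable.ite ((measurable_snd.comp measurable_snd) (measurableSet_singleton (good hS)))
      (by fun_prop) measurable_const
  have hstep := M.lintegral_noiseLaw_step hπ (root hS) H e hΨ
  calc ∫⁻ ω, ENNReal.ofReal (F ω) ∂M.noiseLaw
      = ∫⁻ ω, (if (ω e (stateSeq π (root hS) H ω e) (actionSeq π (root hS) H ω e)).2 = good hS then
          ENNReal.ofReal (H - ((jumpPath π (root hS) H ω e).2 +
            (ω e (stateSeq π (root hS) H ω e) (actionSeq π (root hS) H ω e)).1)) else 0)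
          ∂M.noiseLaw := by
        refine lintegral_congr fun ω => ?_
        have h : ∀ u, ENNReal.ofReal (max u 0) = ENNReal.ofReal u := fun u => by simp
        simp only [hF]
        rw [apply_ite ENNReal.ofReal, h, ENNReal.ofReal_zero]
        rfl
    _ = _ := hstep
    _ = _ := by
        refine lintegral_congr_ae ?_
        filter_upwards [hcomp] with ω hω
        obtain ⟨h1, h2⟩ := hω.stateSeq_mem_level (π := π) (H := H) le_rfl
        have hΨ' : Measurable fun z : ℝ × Fin S => if z.2 = good hS then
            ENNReal.ofReal (H - ((jumpPath π (root hS) H ω e).2 + z.1)) else 0 :=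
          hΨ.comp (measurable_prodMk_left (x := jumpPath π (root hS) H ω e))
        rw [M.lintegral_stepLaw _ _ hΨ',
          ← lintegral_const_mul _ (by fun_prop)]
        refine lintegral_congr fun τ => ?_
        rw [Finset.sum_eq_single (good hS)]
        · rw [if_pos rfl]
          congr 1
          simp only [M, model, trans, dif_neg (not_lt.2 h1), if_pos h2, lottery_apply, if_true]
        · intro y _ hy
          simp [hy]
        · simp

lemma lintegral_remaining (hπ : ∀ x, Measurable (π x)) :
    ∫⁻ ω, ∫⁻ τ, ENNReal.ofReal (H - (timeSeq π (root hS) H ω e + τ)) ∂expMeasure rate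
        ∂(model hS hr b).noiseLaw =
      ENNReal.ofReal (∫ t, max (H - t) 0 ∂gammaMeasure ((e + 1 : ℕ) : ℝ) rate) := by
  rw [← lintegral_remaining_gammaMeasure (by positivity) hr,
    ← CTMDP.lintegral_timeSeq_eq_gamma (M := model hS hr b) (fun _ _ => rfl) hr hπ (root hS) H e
      (f := fun t => ENNReal.ofReal (H - t)) (by fun_prop),
    CTMDP.lintegral_timeSeq_succ (M := model hS hr b) (fun _ _ => rfl) hπ (root hS) H e
      (f := fun t => ENNReal.ofReal (H - t)) (by fun_prop)]

/-- The expected remaining time at the `(e + 1)`-st jump, on the event that the state-action pair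
after the `e`-th jump is `z`. -/
noncomputable def hitWeight (M : CTMDP S A) (hS : S = levelStart A (e + 1) + 2) (rate H : ℝ)
    (π : ControlMap S A) (z : Fin S × Fin A) : ℝ≥0∞ :=
  ∫⁻ ω, if (stateSeq π (root hS) H ω e, actionSeq π (root hS) H ω e) = z then
    ∫⁻ τ, ENNReal.ofReal (H - (timeSeq π (root hS) H ω e + τ)) ∂expMeasure rate else 0 ∂M.noiseLaw

lemma measurable_lintegral_remaining (hr : 0 < rate) (H : ℝ) :
    Measurable fun t => ∫⁻ τ, ENNReal.ofReal (H - (t + τ)) ∂expMeasure rate := by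
  have := isProbabilityMeasure_expMeasure hr
  exact Measurable.lintegral_prod_right' (f := fun q : ℝ × ℝ => ENNReal.ofReal (H - (q.1 + q.2)))
    (by fun_prop)

lemma measurable_hit {α : Type*} [MeasurableSpace α] (hr : 0 < rate) {Q : α → ControlMap S A}
    (hQ : ∀ x, Measurable fun q : α × ℝ => Q q.1 x q.2) (H : ℝ) (z : Fin S × Fin A) :
    Measurable fun q : α × Noise S A =>
      if (stateSeq (Q q.1) (root hS) H q.2 e, actionSeq (Q q.1) (root hS) H q.2 e) = z then
        ∫⁻ τ, ENNReal.ofReal (H - (timeSeq (Q q.1) (root hS) H q.2 e + τ)) ∂expMeasure rate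
      else 0 :=
  Measurable.ite (((measurable_stateSeq hQ _ H e).prodMk (measurable_actionSeq hQ _ H e))
    (measurableSet_singleton z))
    ((measurable_lintegral_remaining hr H).comp (measurable_timeSeq hQ _ H e)) measurable_const

lemma measurable_hit_noise (hr : 0 < rate) (hπ : ∀ x, Measurable (π x)) (H : ℝ)
    (z : Fin S × Fin A) :
    Measurable fun ω : Noise S A =>
      if (stateSeq π (root hS) H ω e, actionSeq π (root hS) H ω e) = z then
        ∫⁻ τ, ENNReal.ofReal (H - (timeSeq π (root hS) H ω e + τ)) ∂expMeasure rate else 0 :=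
  (measurable_hit (hS := hS) hr (Q := fun _ : Unit => π)
    (measurable_control_of_const hπ) H z).comp (measurable_prodMk_left (x := ()))

/-- Exactly one pair is played after jump `e`, so the weights add up to the mean remaining time at
jump `e + 1`, on which the policy has no influence. -/
lemma sum_hitWeight (hπ : ∀ x, Measurable (π x)) :
    ∑ z, hitWeight (model hS hr b) hS rate H π z =
      ENNReal.ofReal (∫ t, max (H - t) 0 ∂gammaMeasure ((e + 1 : ℕ) : ℝ) rate) := by
  simp only [hitWeight]
  rw [← lintegral_finsetSum _ fun z _ => measurable_hit_noise hr hπ H z,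
    ← lintegral_remaining (hS := hS) (b := b) (hr := hr) hπ]
  simp

lemma hitWeight_le (hπ : ∀ x, Measurable (π x)) (z : Fin S × Fin A) :
    hitWeight (model hS hr b) hS rate H π z ≤
      ENNReal.ofReal (∫ t, max (H - t) 0 ∂gammaMeasure ((e + 1 : ℕ) : ℝ) rate) := by
  rw [← sum_hitWeight (b := b) (hr := hr) hπ]
  exact Finset.single_le_sum (f := fun z => hitWeight (model hS hr b) hS rate H π z)
    (fun _ _ => zero_le) (Finset.mem_univ z)

/-- The bias `ε` in favour of the state-action pair `z`. -/
noncomputable def bias (z : Fin S × Fin A) (ε : Icc (0 : ℝ) (1 / 2)) :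
    Fin S → Fin A → Icc (0 : ℝ) (1 / 2) :=
  fun x a => if (x, a) = z then ε else ⟨0, by norm_num⟩

variable {z : Fin S × Fin A} {ε : Icc (0 : ℝ) (1 / 2)}

lemma value_bias (hπ : ∀ x, Measurable (π x)) (hH : 0 ≤ H) :
    (model hS hr (bias z ε)).value H π (root hS) =
      (∫ t, max (H - t) 0 ∂gammaMeasure ((e + 1 : ℕ) : ℝ) rate) / 2 +
        ε * (hitWeight (model hS hr (bias z ε)) hS rate H π z).toReal := by
  obtain ⟨h0, h1⟩ := ofReal_value (hS := hS) (hr := hr) (b := bias z ε) hπ hH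
  set G := ∫ t, max (H - t) 0 ∂gammaMeasure ((e + 1 : ℕ) : ℝ) rate with hG
  have hG0 : 0 ≤ G := integral_nonneg fun t => le_max_right _ _
  have hε := ε.2
  have hlt : hitWeight (model hS hr (bias z ε)) hS rate H π z ≠ ∞ :=
    ((hitWeight_le hπ z).trans_lt ENNReal.ofReal_lt_top).ne
  have hφ : Measurable fun ω : Noise S A =>
      ∫⁻ τ, ENNReal.ofReal (H - (timeSeq π (root hS) H ω e + τ)) ∂expMeasure rate :=
    (measurable_lintegral_remaining hr H).comp (measurable_timeSeq_noise hπ (root hS) H e)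
  have hm := measurable_hit_noise (hS := hS) hr hπ H z
  have h2 : ENNReal.ofReal ((model hS hr (bias z ε)).value H π (root hS)) =
      ENNReal.ofReal (1 / 2) * ENNReal.ofReal G +
        ENNReal.ofReal ε * hitWeight (model hS hr (bias z ε)) hS rate H π z := by
    rw [h1, hG, ← lintegral_remaining (hS := hS) (b := bias z ε) (hr := hr) hπ, hitWeight]
    rw [← lintegral_const_mul _ hφ, ← lintegral_const_mul _ hm,
      ← lintegral_add_left (hφ.const_mul _)]
    refine lintegral_congr fun ω => ?_
    simp only [bias]
    split_ifs
    · rw [ENNReal.ofReal_add (by norm_num) hε.1, add_mul]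
    · simp
  rw [← ENNReal.ofReal_toReal hlt, ← ENNReal.ofReal_mul (by norm_num), ← ENNReal.ofReal_mul hε.1,
    ← ENNReal.ofReal_add (by positivity) (mul_nonneg hε.1 ENNReal.toReal_nonneg),
    ENNReal.ofReal_eq_ofReal_iff h0
      (add_nonneg (by positivity) (mul_nonneg hε.1 ENNReal.toReal_nonneg))] at h2
  rw [h2]
  ring

lemma le_optValue_bias (hH : 0 ≤ H) (hz1 : levelStart A e ≤ z.1.1)
    (hz2 : z.1.1 < levelStart A (e + 1)) :
    (∫ t, max (H - t) 0 ∂gammaMeasure ((e + 1 : ℕ) : ℝ) rate) / 2 +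
        ε * (∫ t, max (H - t) 0 ∂gammaMeasure ((e + 1 : ℕ) : ℝ) rate) ≤
      (model hS hr (bias z ε)).optValue H (root hS) := by
  set G := ∫ t, max (H - t) 0 ∂gammaMeasure ((e + 1 : ℕ) : ℝ) rate with hG
  have hG0 : 0 ≤ G := integral_nonneg fun t => le_max_right _ _
  have hε := ε.2
  have hle : ∀ π : Policy S A, (hitWeight (model hS hr (bias z ε)) hS rate H π.1 z).toReal ≤ G :=
    fun π => ENNReal.toReal_le_of_le_ofReal hG0 (hitWeight_le π.2 z)
  -- Without this bound the real supremum would take its default value 0.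
  have hbdd : BddAbove (range fun π : Policy S A =>
      (model hS hr (bias z ε)).value H π.1 (root hS)) := by
    refine ⟨G / 2 + ε * G, ?_⟩
    rintro _ ⟨π, rfl⟩
    simp only
    rw [value_bias π.2 hH]
    have := mul_le_mul_of_nonneg_left (hle π) hε.1
    linarith
  obtain ⟨ρ, hρ, hreach⟩ := exists_stationary (hS := hS) e le_rfl z.1 hz1 hz2 z.2
  have hρm : ∀ x, Measurable (stationary ρ x) := fun x => measurable_const
  have hopt := le_ciSup hbdd ⟨stationary ρ, hρm⟩
  have hhit : hitWeight (model hS hr (bias z ε)) hS rate H (stationary ρ) z = ENNReal.ofReal G := by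
    rw [hG, ← lintegral_remaining (hS := hS) (b := bias z ε) (hr := hr) hρm, hitWeight]
    refine lintegral_congr_ae ?_
    filter_upwards [ae_compatible (hS := hS) hr (bias z ε)] with ω hω
    rw [if_pos]
    rw [actionSeq, hreach H ω hω, stationary, hρ]
  simp only at hopt
  rwa [value_bias hρm hH, hhit, ENNReal.toReal_ofReal hG0] at hopt

end Value

end TreeModel

/-! ### Comparing noise laws by redirecting jumps -/

lemma lintegral_eq_of_map_eq {Ω : Type*} [MeasurableSpace Ω] {P P' : Measure Ω} {T : Ω → Ω}
    {K : Ω → ℝ≥0∞} (hT : Measurable T) (hK : Measurable K) (h : P.map T = P'.map T)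
    (hP : ∀ᵐ ω ∂P, K (T ω) = K ω) (hP' : ∀ᵐ ω ∂P', K (T ω) = K ω) :
    ∫⁻ ω, K ω ∂P = ∫⁻ ω, K ω ∂P' := by
  rw [← lintegral_congr_ae hP, ← lintegral_congr_ae hP', ← lintegral_map hK hT, h,
    lintegral_map hK hT]

namespace CTMDP

variable {S A : ℕ} (M M' : CTMDP S A) (z : Fin S × Fin A) (y₀ : Fin S)

/-- The law of the noise between two successive jumps. -/
noncomputable def entryLaw : Measure (Fin S → Fin A → ℝ × Fin S) :=
  Measure.pi fun x => Measure.pi fun a => M.stepLaw x a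

instance : IsProbabilityMeasure M.entryLaw := by
  unfold entryLaw; infer_instance

/-- Replace the next state by `y₀` at the state-action pair `z`. -/
def redirect (y : Fin S → Fin A → ℝ × Fin S) : Fin S → Fin A → ℝ × Fin S :=
  fun x a => if (x, a) = z then ((y x a).1, y₀) else y x a

lemma measurable_redirect : Measurable (redirect z y₀) := by
  refine measurable_pi_iff.2 fun x => measurable_pi_iff.2 fun a => ?_
  unfold redirect
  split_ifs <;> fun_prop

open Classical in
/-- Redirect the jumps from `z` to `y₀` in the steps that belong to `J`. -/
noncomputable def scramble (J : Set ℕ) (ω : Noise S A) : Noise S A :=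
  fun n => if n ∈ J then redirect z y₀ (ω n) else ω n

lemma measurable_scramble (J : Set ℕ) : Measurable (scramble z y₀ J) := by
  refine measurable_pi_iff.2 fun n => ?_
  unfold scramble
  split_ifs
  · exact (measurable_redirect z y₀).comp (measurable_pi_apply n)
  · exact measurable_pi_apply n

lemma scramble_apply_fst (J : Set ℕ) (ω : Noise S A) (n : ℕ) (x : Fin S) (a : Fin A) :
    (scramble z y₀ J ω n x a).1 = (ω n x a).1 := by
  unfold scramble
  split_ifs
  · simp only [redirect]
    split_ifs <;> rfl
  · rfl

lemma scramble_apply_of_ne (J : Set ℕ) (ω : Noise S A) (n : ℕ) {x : Fin S} {a : Fin A}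
    (h : n ∈ J → (x, a) ≠ z) : scramble z y₀ J ω n x a = ω n x a := by
  unfold scramble
  split_ifs with hn
  · simp [redirect, h hn]
  · rfl

variable {M M' z}

/-- Once the destination at `z` is erased, only the holding time is left there, and its rate is the
same in both models. -/
lemma map_redirect_stepLaw (hrate : ∀ x a, M'.rate x a = M.rate x a)
    (hoff : ∀ x a, (x, a) ≠ z → M'.stepLaw x a = M.stepLaw x a) :
    M'.entryLaw.map (redirect z y₀) = M.entryLaw.map (redirect z y₀) := by
  let t : Fin S → Fin A → ℝ × Fin S → ℝ × Fin S := fun x a q =>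
    if (x, a) = z then (q.1, y₀) else q
  have ht : ∀ x a, Measurable (t x a) := fun x a => by
    simp only [t]; split_ifs <;> fun_prop
  have hpi : ∀ M : CTMDP S A, M.entryLaw.map (redirect z y₀) =
      Measure.pi fun x => Measure.pi fun a => (M.stepLaw x a).map (t x a) := by
    intro M
    have hp : ∀ x a, IsProbabilityMeasure ((M.stepLaw x a).map (t x a)) := fun x a =>
      Measure.isProbabilityMeasure_map (ht x a).aemeasurable
    have h1 : ∀ x, (Measure.pi fun a => M.stepLaw x a).map (fun w a => t x a (w a)) =
        Measure.pi fun a => (M.stepLaw x a).map (t x a) := fun x =>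
      Measure.pi_map_pi fun a => (ht x a).aemeasurable
    have hp' : ∀ x, IsProbabilityMeasure
        ((Measure.pi fun a => M.stepLaw x a).map (fun w a => t x a (w a))) := fun x => by
      rw [h1]; infer_instance
    simp_rw [← h1]
    exact Measure.pi_map_pi fun x => (measurable_pi_iff.2 fun a =>
      (ht x a).comp (measurable_pi_apply a)).aemeasurable
  have hstep : ∀ x a, (M'.stepLaw x a).map (t x a) = (M.stepLaw x a).map (t x a) := by
    intro x a
    by_cases h : (x, a) = z
    · have hz : ∀ M : CTMDP S A, (M.stepLaw x a).map (t x a) =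
          (expMeasure (M.rate x a)).prod (Measure.dirac y₀) := by
        intro M
        have := isProbabilityMeasure_expMeasure (M.rate_pos x a)
        have hid : t x a = Prod.map id fun _ => y₀ := by
          funext q; simp only [t, if_pos h]; rfl
        rw [hid, stepLaw, ← Measure.map_prod_map _ _ measurable_id measurable_const,
          Measure.map_id, Measure.map_const]
        simp
      rw [hz, hz, hrate]
    · rw [hoff x a h]
  rw [hpi, hpi]
  simp_rw [hstep]

open Classical in
lemma map_scramble_noiseLaw (M : CTMDP S A) (z : Fin S × Fin A) (J : Set ℕ) :
    M.noiseLaw.map (scramble z y₀ J) =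
      Measure.infinitePi fun n => if n ∈ J then M.entryLaw.map (redirect z y₀) else M.entryLaw := by
  have h := Measure.infinitePi_map_pi (μ := fun _ : ℕ => M.entryLaw)
    (f := fun n => if n ∈ J then redirect z y₀ else id) (fun n => by
      split_ifs
      · exact measurable_redirect z y₀
      · exact measurable_id)
  have h2 : (fun n => M.entryLaw.map (if n ∈ J then redirect z y₀ else id)) =
      fun n => if n ∈ J then M.entryLaw.map (redirect z y₀) else M.entryLaw := by
    funext n
    split_ifs
    · rfl
    · exact Measure.map_id
  rw [h2] at h
  rw [← h]
  congr 1
  funext ω n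
  simp only [scramble]
  split_ifs <;> rfl

lemma entryLaw_withDensity {g : Fin S → ℝ≥0∞}
    (hoff : ∀ x a, (x, a) ≠ z → M'.stepLaw x a = M.stepLaw x a)
    (hz : M'.stepLaw z.1 z.2 = (M.stepLaw z.1 z.2).withDensity fun q => g q.2) :
    M'.entryLaw = M.entryLaw.withDensity fun y => g (y z.1 z.2).2 := by
  have hg : Measurable g := .of_discrete
  refine pi_withDensity_eval (fun x => Measure.pi fun a => M.stepLaw x a)
    (fun x => Measure.pi fun a => M'.stepLaw x a) z.1 (g := fun w => g (w z.2).2) (by fun_prop)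
    (pi_withDensity_eval (fun a => M.stepLaw z.1 a) (fun a => M'.stepLaw z.1 a) z.2
      (g := fun q => g q.2) (by fun_prop) hz fun a ha => hoff _ _ ?_) fun x hx => ?_
  · exact fun h => ha (congrArg Prod.snd h)
  · simp_rw [hoff x _ fun h => hx (congrArg Prod.fst h)]

/-- If the jumps from `z` are redirected in all steps but one, then changing the transition
probabilities from `z` changes the law of the noise by a density that depends on that step only. -/
lemma map_scramble_withDensity {g : Fin S → ℝ≥0∞} (hrate : ∀ x a, M'.rate x a = M.rate x a)
    (hoff : ∀ x a, (x, a) ≠ z → M'.stepLaw x a = M.stepLaw x a)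
    (hz : M'.stepLaw z.1 z.2 = (M.stepLaw z.1 z.2).withDensity fun q => g q.2) (e : ℕ) :
    M'.noiseLaw.map (scramble z y₀ {e}ᶜ) =
      (M.noiseLaw.map (scramble z y₀ {e}ᶜ)).withDensity fun ω => g (ω e z.1 z.2).2 := by
  classical
  have hg : Measurable g := .of_discrete
  have hp : ∀ (M : CTMDP S A) (n : ℕ), IsProbabilityMeasure
      (if n ∈ ({e}ᶜ : Set ℕ) then M.entryLaw.map (redirect z y₀) else M.entryLaw) := by
    intro M n
    split_ifs
    · exact Measure.isProbabilityMeasure_map (measurable_redirect z y₀).aemeasurable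
    · infer_instance
  have := hp M
  have := hp M'
  have hgm : Measurable fun y : Fin S → Fin A → ℝ × Fin S => g (y z.1 z.2).2 := by fun_prop
  have hin : ∀ n, n ≠ e → n ∈ ({e}ᶜ : Set ℕ) := fun n hn => hn
  have hnot : e ∉ ({e}ᶜ : Set ℕ) := fun h => h rfl
  have key := infinitePi_withDensity_eval
    (fun n => if n ∈ ({e}ᶜ : Set ℕ) then M.entryLaw.map (redirect z y₀) else M.entryLaw)
    (fun n => if n ∈ ({e}ᶜ : Set ℕ) then M'.entryLaw.map (redirect z y₀) else M'.entryLaw) e hgm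
    (by rw [if_neg hnot, if_neg hnot]; exact entryLaw_withDensity hoff hz)
    (fun n hn => by rw [if_pos (hin n hn), if_pos (hin n hn), map_redirect_stepLaw y₀ hrate hoff])
  rw [map_scramble_noiseLaw, map_scramble_noiseLaw]
  convert key

lemma map_scramble_univ (hrate : ∀ x a, M'.rate x a = M.rate x a)
    (hoff : ∀ x a, (x, a) ≠ z → M'.stepLaw x a = M.stepLaw x a) :
    M'.noiseLaw.map (scramble z y₀ univ) = M.noiseLaw.map (scramble z y₀ univ) := by
  rw [map_scramble_noiseLaw, map_scramble_noiseLaw]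
  simp [map_redirect_stepLaw y₀ hrate hoff]

/-- The two noise laws may differ at `z` in every one of infinitely many steps, so a density between
them need not exist. A functional that ignores the destinations at `z` outside step `e` only sees
the redirected laws, which differ in step `e` alone. -/
lemma lintegral_noiseLaw_withDensity {g : Fin S → ℝ≥0∞} (hrate : ∀ x a, M'.rate x a = M.rate x a)
    (hoff : ∀ x a, (x, a) ≠ z → M'.stepLaw x a = M.stepLaw x a)
    (hz : M'.stepLaw z.1 z.2 = (M.stepLaw z.1 z.2).withDensity fun q => g q.2) (e : ℕ)
    {K : Noise S A → ℝ≥0∞} (hK : Measurable K)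
    (h : ∀ᵐ ω ∂M.noiseLaw, K (scramble z y₀ {e}ᶜ ω) = K ω)
    (h' : ∀ᵐ ω ∂M'.noiseLaw, K (scramble z y₀ {e}ᶜ ω) = K ω) :
    ∫⁻ ω, K ω ∂M'.noiseLaw = ∫⁻ ω, g (ω e z.1 z.2).2 * K ω ∂M.noiseLaw := by
  have hg : Measurable g := .of_discrete
  have hT := measurable_scramble z y₀ {e}ᶜ
  have hgm : Measurable fun ω : Noise S A => g (ω e z.1 z.2).2 := by fun_prop
  rw [← lintegral_congr_ae h', ← lintegral_map hK hT, map_scramble_withDensity y₀ hrate hoff hz e,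
    lintegral_withDensity_eq_lintegral_mul _ hgm hK, lintegral_map (hgm.mul hK) hT]
  refine lintegral_congr_ae ?_
  filter_upwards [h] with ω hω
  rw [Pi.mul_apply, hω]
  simp [scramble]

end CTMDP

lemma observe_congr {S A : ℕ} {π : ControlMap S A} {x : Fin S} {H : ℝ} {ω ω' : Noise S A}
    (h : ∀ n, jumpPath π x H ω' n = jumpPath π x H ω n) : observe π x H ω' = observe π x H ω := by
  funext n
  simp only [observe, stateSeq_congr (h n), actionSeq_congr (h n), timeSeq_congr (h n),
    timeSeq_congr (h (n + 1))]

/-! ### The likelihood ratio of one episode -/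

namespace TreeModel

variable {S A e : ℕ} {hS : S = levelStart A (e + 1) + 2} {rate : ℝ} {hr : 0 < rate}

/-- The recorded episodes in which the state-action pair after the `e`-th jump is `z` and the
`(e + 1)`-st jump was observed. -/
def tested (e : ℕ) (z : Fin S × Fin A) : Set (EpisodeData S A) :=
  {o | o e ∈ Sum.inl '' {t : Fin S × Fin A × ℝ | (t.1, t.2.1) = z} ∧
    o (e + 1) ∈ range (Sum.inl : Fin S × Fin A × ℝ → (Fin S × Fin A × ℝ) ⊕ Unit)}

/-- The recorded episodes in which the `(e + 1)`-st jump was observed to lead to the good state. -/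
def success (hS : S = levelStart A (e + 1) + 2) : Set (EpisodeData S A) :=
  {o | o (e + 1) ∈ Sum.inl '' {t : Fin S × Fin A × ℝ | t.1 = good hS}}

lemma measurableSet_tested (e : ℕ) (z : Fin S × Fin A) : MeasurableSet (tested e z) := by
  have h1 : MeasurableSet {t : Fin S × Fin A × ℝ | (t.1, t.2.1) = z} :=
    (show Measurable fun t : Fin S × Fin A × ℝ => (t.1, t.2.1) by fun_prop)
      (measurableSet_singleton z)
  have h2 : MeasurableSet (range (Sum.inl : Fin S × Fin A × ℝ → (Fin S × Fin A × ℝ) ⊕ Unit)) :=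
    measurableSet_range_inl
  have h3 : ∀ n, Measurable fun o : EpisodeData S A => o n := measurable_pi_apply
  exact (h3 e h1.inl_image).inter (h3 (e + 1) h2)

lemma measurableSet_success : MeasurableSet (success hS : Set (EpisodeData S A)) := by
  have h1 : MeasurableSet {t : Fin S × Fin A × ℝ | t.1 = good hS} :=
    measurable_fst (measurableSet_singleton _)
  exact (measurable_pi_apply (e + 1)) h1.inl_image

open Classical in
/-- The likelihood ratio, on the data of one episode, of the bias `ε` in favour of `z` against
no bias. -/
noncomputable def likelihood (hS : S = levelStart A (e + 1) + 2) (z : Fin S × Fin A) (ε : ℝ)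
    (o : EpisodeData S A) : ℝ :=
  if o ∈ tested e z then if o ∈ success hS then 1 + 2 * ε else 1 - 2 * ε else 1

lemma measurable_likelihood (z : Fin S × Fin A) (ε : ℝ) : Measurable (likelihood hS z ε) := by
  classical
  exact Measurable.ite (measurableSet_tested e z)
    (Measurable.ite measurableSet_success measurable_const measurable_const) measurable_const

variable {π : ControlMap S A} {H : ℝ} {ω : Noise S A} {z : Fin S × Fin A}

/-- Entry `e + 1` is recorded precisely when that jump occurs by time `H`, and then entry `e` is
recorded too. -/
lemma Compatible.observe_mem_tested (hω : Compatible hS ω) :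
    observe π (root hS) H ω ∈ tested e z ↔
      (stateSeq π (root hS) H ω e, actionSeq π (root hS) H ω e) = z ∧
        timeSeq π (root hS) H ω (e + 1) ≤ H := by
  have hmono := monotone_timeSeq (π := π) (x := root hS) (H := H) hω.time_pos e.le_succ
  simp only [tested, observe, mem_ofPred_eq]
  by_cases h1 : timeSeq π (root hS) H ω (e + 1) ≤ H
  · simp [h1, hmono.trans h1]
  · simp [h1]

lemma Compatible.observe_mem_success (hω : Compatible hS ω)
    (h : observe π (root hS) H ω ∈ tested e z) :
    observe π (root hS) H ω ∈ success hS ↔ (ω e z.1 z.2).2 = good hS := by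
  obtain ⟨h1, h2⟩ := hω.observe_mem_tested.1 h
  subst h1
  change _ ↔ stateSeq π (root hS) H ω (e + 1) = good hS
  simp [success, observe, h2, eq_comm]

/-! ### Redirected noise -/

/-- A leaf is visited at step `e` or not at all, so the entries at `z` in other steps are never
used. -/
lemma Compatible.jumpPath_scramble_compl (hω : Compatible hS ω) (hz1 : levelStart A e ≤ z.1.1)
    (hz2 : z.1.1 < levelStart A (e + 1)) (n : ℕ) :
    jumpPath π (root hS) H (CTMDP.scramble z (bad hS) {e}ᶜ ω) n = jumpPath π (root hS) H ω n := by
  refine jumpPath_congr fun m _ => CTMDP.scramble_apply_of_ne z _ _ _ _ ?_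
  rintro hm rfl
  exact hm (hω.eq_of_stateSeq_leaf hz1 hz2)

lemma Compatible.jumpPath_scramble_univ (hω : Compatible hS ω) (hz1 : levelStart A e ≤ z.1.1)
    (hz2 : z.1.1 < levelStart A (e + 1)) {n : ℕ} (hn : n ≤ e) :
    jumpPath π (root hS) H (CTMDP.scramble z (bad hS) univ ω) n = jumpPath π (root hS) H ω n := by
  refine jumpPath_congr fun m hm => CTMDP.scramble_apply_of_ne z _ _ _ _ ?_
  rintro - rfl
  have := hω.eq_of_stateSeq_leaf hz1 hz2
  omega

/-- The bad state is an admissible destination from a leaf, so the path lemmas also apply to the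
redirected noise. -/
lemma Compatible.scramble_univ (hω : Compatible hS ω) (hz1 : levelStart A e ≤ z.1.1)
    (hz2 : z.1.1 < levelStart A (e + 1)) :
    Compatible hS (CTMDP.scramble z (bad hS) univ ω) := by
  intro n x a
  by_cases h : (x, a) = z
  · subst h
    refine ⟨by rw [CTMDP.scramble_apply_fst]; exact hω.time_pos n x a, fun h => ?_,
      fun _ _ => ?_, fun h => ?_⟩
    · simp only at hz1; omega
    · right; simp [CTMDP.scramble, CTMDP.redirect]
    · simp only at hz2; omega
  · rw [CTMDP.scramble_apply_of_ne z _ _ _ _ fun _ => h]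
    exact hω n x a

/-- Without the information where the tested jump leads to, nothing is learnt from an episode. -/
lemma Compatible.observe_scramble_univ (hω : Compatible hS ω) (hz1 : levelStart A e ≤ z.1.1)
    (hz2 : z.1.1 < levelStart A (e + 1)) :
    (observe π (root hS) H (CTMDP.scramble z (bad hS) univ ω) ∈ tested e z ↔
      observe π (root hS) H ω ∈ tested e z) ∧
    (observe π (root hS) H ω ∉ tested e z →
      observe π (root hS) H (CTMDP.scramble z (bad hS) univ ω) = observe π (root hS) H ω) := by
  have hω' := hω.scramble_univ hz1 hz2
  set ω' := CTMDP.scramble z (bad hS) univ ω with hω'_def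
  have hpath : ∀ n ≤ e, jumpPath π (root hS) H ω' n = jumpPath π (root hS) H ω n := fun n hn =>
    hω.jumpPath_scramble_univ hz1 hz2 hn
  have htime : timeSeq π (root hS) H ω' (e + 1) = timeSeq π (root hS) H ω (e + 1) := by
    rw [timeSeq_succ, timeSeq_succ, stateSeq_congr (hpath e le_rfl),
      actionSeq_congr (hpath e le_rfl), timeSeq_congr (hpath e le_rfl), hω'_def,
      CTMDP.scramble_apply_fst]
  refine ⟨?_, fun h => ?_⟩
  · rw [hω'.observe_mem_tested, hω.observe_mem_tested, htime, stateSeq_congr (hpath e le_rfl),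
      actionSeq_congr (hpath e le_rfl)]
  rw [hω.observe_mem_tested] at h
  -- Either `z` was played but the jump came after `H`: its destination is unrecorded and the
  -- holding time is truncated. Or `z` was not played, and the redirected entries were not used.
  by_cases hz : (stateSeq π (root hS) H ω e, actionSeq π (root hS) H ω e) = z
  · have hH : H < timeSeq π (root hS) H ω (e + 1) := not_le.1 fun h' => h ⟨hz, h'⟩
    funext n
    rcases Nat.lt_or_ge e n with hn | hn
    · have h1 := monotone_timeSeq (π := π) (x := root hS) (H := H) hω.time_pos
        (show e + 1 ≤ n from hn)
      have h2 := monotone_timeSeq (π := π) (x := root hS) (H := H) hω'.time_pos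
        (show e + 1 ≤ n from hn)
      rw [observe, observe, if_neg (not_le.2 (hH.trans_le h1)),
        if_neg (not_le.2 ((htime ▸ hH).trans_le h2))]
    · have hn' : timeSeq π (root hS) H ω' (n + 1) = timeSeq π (root hS) H ω (n + 1) := by
        rcases hn.eq_or_lt with rfl | hn
        · exact htime
        · exact timeSeq_congr (hpath (n + 1) hn)
      simp only [observe, stateSeq_congr (hpath n hn), actionSeq_congr (hpath n hn),
        timeSeq_congr (hpath n hn), hn']
  · refine observe_congr fun n => jumpPath_congr fun m _ =>
      CTMDP.scramble_apply_of_ne z _ _ _ _ ?_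
    rintro - rfl
    obtain rfl := hω.eq_of_stateSeq_leaf hz1 hz2
    exact hz rfl

/-! ### Change of measure -/

/-- No bias. -/
noncomputable def unbiased : Fin S → Fin A → Icc (0 : ℝ) (1 / 2) := fun _ _ => ⟨0, by norm_num⟩

variable {ε : Icc (0 : ℝ) (1 / 2)}

lemma stepLaw_bias_of_ne {x : Fin S} {a : Fin A} (h : (x, a) ≠ z) :
    (model hS hr (bias z ε)).stepLaw x a = (model hS hr unbiased).stepLaw x a := by
  simp only [CTMDP.stepLaw, model, trans, bias, if_neg h, unbiased]

/-- The density of the jumps from the favoured pair with respect to unbiased jumps. -/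
noncomputable def jumpRatio (hS : S = levelStart A (e + 1) + 2) (ε : ℝ) (y : Fin S) : ℝ :=
  if y = good hS then 1 + 2 * ε else 1 - 2 * ε

lemma stepLaw_bias (hz1 : levelStart A e ≤ z.1.1) (hz2 : z.1.1 < levelStart A (e + 1)) :
    (model hS hr (bias z ε)).stepLaw z.1 z.2 =
      ((model hS hr unbiased).stepLaw z.1 z.2).withDensity
        fun q => ENNReal.ofReal (jumpRatio hS ε q.2) := by
  have hε := ε.2
  have := isProbabilityMeasure_expMeasure hr
  have hg : Measurable fun y : Fin S => ENNReal.ofReal (jumpRatio hS ε y) := .of_discrete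
  simp only [CTMDP.stepLaw, model]
  rw [← prod_withDensity_right hg]
  congr 1
  refine Measure.ext_of_singleton fun y => ?_
  rw [withDensity_apply _ (measurableSet_singleton y), lintegral_singleton,
    PMF.toMeasure_apply_singleton _ _ (measurableSet_singleton y),
    PMF.toMeasure_apply_singleton _ _ (measurableSet_singleton y)]
  simp only [trans, dif_neg (not_lt.2 hz1), if_pos hz2, lottery_apply, bias, unbiased, jumpRatio,
    if_true]
  -- The ratios are (1/2 ± ε) / (1/2). Outside the two absorbing states both masses vanish, so the
  -- value of `jumpRatio` there is irrelevant.
  split_ifs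
  · rw [← ENNReal.ofReal_mul (by linarith [hε.1])]
    congr 1; ring
  · rw [← ENNReal.ofReal_mul (by linarith [hε.2])]
    congr 1; ring
  · simp

/-- The law of the data of one episode in the biased model has density `likelihood` with respect
to that in the unbiased model. -/
lemma lintegral_observe_bias (hπ : ∀ x, Measurable (π x)) (hz1 : levelStart A e ≤ z.1.1)
    (hz2 : z.1.1 < levelStart A (e + 1)) {F : EpisodeData S A → ℝ≥0∞} (hF : Measurable F) :
    ∫⁻ ω, F (observe π (root hS) H ω) ∂(model hS hr (bias z ε)).noiseLaw =
      ∫⁻ ω, ENNReal.ofReal (likelihood hS z ε (observe π (root hS) H ω)) *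
        F (observe π (root hS) H ω) ∂(model hS hr unbiased).noiseLaw := by
  classical
  have hobs := measurable_observe_noise hπ (root hS) H
  have hT := measurableSet_tested (S := S) (A := A) e z
  set F₁ := (tested e z).indicator F with hF₁
  set F₂ := (tested e z)ᶜ.indicator F with hF₂
  have hF₁m : Measurable F₁ := hF.indicator hT
  have hF₂m : Measurable F₂ := hF.indicator hT.compl
  have hsplit : ∀ o, F o = F₁ o + F₂ o := fun o =>
    (congrFun (indicator_self_add_compl (tested e z) F) o).symm
  have hrate : ∀ x a, (model hS hr (bias z ε)).rate x a = (model hS hr unbiased).rate x a :=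
    fun _ _ => rfl
  have hc := ae_compatible (hS := hS) hr (unbiased : Fin S → Fin A → _)
  have hc' := ae_compatible (hS := hS) hr (bias z ε)
  -- On tested episodes the density read from the noise at step `e` is visible in the data, so it
  -- may be replaced by `likelihood` below.
  have h1 : ∫⁻ ω, F₁ (observe π (root hS) H ω) ∂(model hS hr (bias z ε)).noiseLaw =
      ∫⁻ ω, ENNReal.ofReal (jumpRatio hS ε (ω e z.1 z.2).2) * F₁ (observe π (root hS) H ω)
        ∂(model hS hr unbiased).noiseLaw := by
    refine CTMDP.lintegral_noiseLaw_withDensity (bad hS)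
      (g := fun y => ENNReal.ofReal (jumpRatio hS ε y)) hrate (fun x a => stepLaw_bias_of_ne)
      (stepLaw_bias hz1 hz2) e (hF₁m.comp hobs) ?_ ?_
    · filter_upwards [hc] with ω hω
      rw [observe_congr (hω.jumpPath_scramble_compl hz1 hz2)]
    · filter_upwards [hc'] with ω hω
      rw [observe_congr (hω.jumpPath_scramble_compl hz1 hz2)]
  -- On untested episodes the destination is not in the data; erasing it in all steps shows that the
  -- two models agree there.
  have h2 : ∫⁻ ω, F₂ (observe π (root hS) H ω) ∂(model hS hr (bias z ε)).noiseLaw =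
      ∫⁻ ω, F₂ (observe π (root hS) H ω) ∂(model hS hr unbiased).noiseLaw := by
    have hinv : ∀ ω, Compatible hS ω →
        F₂ (observe π (root hS) H (CTMDP.scramble z (bad hS) univ ω)) =
          F₂ (observe π (root hS) H ω) := by
      intro ω hω
      obtain ⟨h3, h4⟩ := hω.observe_scramble_univ (π := π) (H := H) hz1 hz2
      by_cases h : observe π (root hS) H ω ∈ tested e z
      · rw [hF₂, indicator_of_notMem (notMem_compl_iff.2 h),
          indicator_of_notMem (notMem_compl_iff.2 (h3.2 h))]
      · rw [h4 h]
    exact lintegral_eq_of_map_eq (CTMDP.measurable_scramble z (bad hS) univ) (hF₂m.comp hobs)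
      (CTMDP.map_scramble_univ (bad hS) hrate fun x a => stepLaw_bias_of_ne)
      (hc'.mono hinv) (hc.mono hinv)
  have hF₁o : Measurable fun ω : Noise S A => F₁ (observe π (root hS) H ω) := hF₁m.comp hobs
  have hF₂o : Measurable fun ω : Noise S A => F₂ (observe π (root hS) H ω) := hF₂m.comp hobs
  simp_rw [hsplit]
  rw [lintegral_add_left hF₁o, h1, h2, ← lintegral_add_right _ hF₂o]
  refine lintegral_congr_ae ?_
  filter_upwards [hc] with ω hω
  by_cases h : observe π (root hS) H ω ∈ tested e z
  · rw [hF₂, indicator_of_notMem (notMem_compl_iff.2 h), add_zero, add_zero, likelihood, if_pos h,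
      jumpRatio]
    simp_rw [hω.observe_mem_success h]
  · rw [hF₁, indicator_of_notMem h, mul_zero, zero_add, likelihood, if_neg h,
      ENNReal.ofReal_one, one_mul]

/-- The weight depends on the noise only through the first `e` jumps, before the biased destination
can matter. -/
lemma hitWeight_bias (hπ : ∀ x, Measurable (π x)) (hz1 : levelStart A e ≤ z.1.1)
    (hz2 : z.1.1 < levelStart A (e + 1)) :
    hitWeight (model hS hr (bias z ε)) hS rate H π z =
      hitWeight (model hS hr unbiased) hS rate H π z := by
  have hinv : ∀ ω, Compatible hS ω →
      (if (stateSeq π (root hS) H (CTMDP.scramble z (bad hS) univ ω) e,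
          actionSeq π (root hS) H (CTMDP.scramble z (bad hS) univ ω) e) = z then
        ∫⁻ τ, ENNReal.ofReal (H - (timeSeq π (root hS) H
          (CTMDP.scramble z (bad hS) univ ω) e + τ)) ∂expMeasure rate else 0) =
      if (stateSeq π (root hS) H ω e, actionSeq π (root hS) H ω e) = z then
        ∫⁻ τ, ENNReal.ofReal (H - (timeSeq π (root hS) H ω e + τ)) ∂expMeasure rate else 0 := by
    intro ω hω
    have h := hω.jumpPath_scramble_univ (π := π) (H := H) hz1 hz2 le_rfl
    rw [stateSeq_congr h, actionSeq_congr h, timeSeq_congr h]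
  exact lintegral_eq_of_map_eq (CTMDP.measurable_scramble z (bad hS) univ)
    (measurable_hit_noise hr hπ H z)
    (CTMDP.map_scramble_univ (bad hS) (fun _ _ => rfl) fun x a => stepLaw_bias_of_ne)
    ((ae_compatible hS hr _).mono hinv) ((ae_compatible hS hr _).mono hinv)

end TreeModel

/-! ### The likelihood ratio of the data of several episodes -/

namespace CTMDP

variable {S A : ℕ} (M : CTMDP S A) (H : ℝ) (algo : Algorithm S A)

lemma measurable_dataStep (k : ℕ) :
    Measurable fun q : (ℝ × (Fin k → EpisodeData S A)) × Noise S A =>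
      ((q.1.1, Fin.snoc q.1.2 (observe (algo.policy M.r M.x₀ k q.1) M.x₀ H q.2)) :
        ℝ × (Fin (k + 1) → EpisodeData S A)) := by
  have hobs := measurable_observe (Q := algo.policy M.r M.x₀ k)
    (algo.measurable_policy M.r M.x₀ k) M.x₀ H
  refine (measurable_fst.comp measurable_fst).prodMk (measurable_pi_iff.2 fun i => ?_)
  induction i using Fin.lastCases with
  | last => simpa only [Fin.snoc_last] using hobs
  | cast i => simp only [Fin.snoc_castSucc]; fun_prop

instance (k : ℕ) : IsProbabilityMeasure (M.dataLaw H algo k) := by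
  induction k with
  | zero =>
    have := algo.isProbabilityMeasure_seedLaw
    exact Measure.isProbabilityMeasure_map
      (measurable_id.prodMk measurable_const : Measurable fun s : ℝ => (s, Fin.elim0)).aemeasurable
  | succ k ih => exact Measure.isProbabilityMeasure_map (M.measurable_dataStep H algo k).aemeasurable

lemma lintegral_dataLaw_succ (k : ℕ) {F : ℝ × (Fin (k + 1) → EpisodeData S A) → ℝ≥0∞}
    (hF : Measurable F) :
    ∫⁻ h, F h ∂M.dataLaw H algo (k + 1) =
      ∫⁻ h, ∫⁻ ω, F (h.1, Fin.snoc h.2 (observe (algo.policy M.r M.x₀ k h) M.x₀ H ω))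
        ∂M.noiseLaw ∂M.dataLaw H algo k := by
  rw [dataLaw, lintegral_map hF (M.measurable_dataStep H algo k)]
  exact lintegral_prod _ (hF.comp (M.measurable_dataStep H algo k)).aemeasurable

lemma measurable_policy_apply {α : Type*} [MeasurableSpace α] (algo : Algorithm S A)
    (r : Fin S → Fin A → ℝ) (x₀ : Fin S) (k : ℕ) {f : α → ℝ × (Fin k → EpisodeData S A)}
    (hf : Measurable f) (x : Fin S) :
    Measurable fun q : α × ℝ => algo.policy r x₀ k (f q.1) x q.2 :=
  (algo.measurable_policy r x₀ k x).comp ((hf.comp measurable_fst).prodMk measurable_snd)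

lemma measurable_policy (algo : Algorithm S A) (r : Fin S → Fin A → ℝ) (x₀ : Fin S) (k : ℕ)
    (h : ℝ × (Fin k → EpisodeData S A)) (x : Fin S) : Measurable (algo.policy r x₀ k h x) :=
  (algo.measurable_policy r x₀ k x).comp (measurable_const.prodMk measurable_id)

end CTMDP

namespace TreeModel

variable {S A e : ℕ} {hS : S = levelStart A (e + 1) + 2} {rate : ℝ} {hr : 0 < rate}
  {H : ℝ} {algo : Algorithm S A} {z : Fin S × Fin A}

lemma likelihood_mem_Icc {ε : ℝ} (h0 : 0 ≤ ε) (h1 : ε ≤ 1 / 4) (o : EpisodeData S A) :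
    likelihood hS z ε o ∈ Icc (1 / 2 : ℝ) 2 := by
  unfold likelihood
  split_ifs <;> constructor <;> linarith

/-- The likelihood ratio of the data of all episodes. -/
noncomputable def dataLikelihood (hS : S = levelStart A (e + 1) + 2) (z : Fin S × Fin A) (ε : ℝ)
    {k : ℕ} (h : ℝ × (Fin k → EpisodeData S A)) : ℝ :=
  ∏ i, likelihood hS z ε (h.2 i)

lemma measurable_dataLikelihood (ε : ℝ) (k : ℕ) :
    Measurable fun h : ℝ × (Fin k → EpisodeData S A) => dataLikelihood hS z ε h :=
  Finset.measurable_prod _ fun i _ => (measurable_likelihood z ε).comp (by fun_prop)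

lemma dataLikelihood_pos {ε : ℝ} (h0 : 0 ≤ ε) (h1 : ε ≤ 1 / 4) {k : ℕ}
    (h : ℝ × (Fin k → EpisodeData S A)) : 0 < dataLikelihood hS z ε h :=
  Finset.prod_pos fun i _ => by linarith [(likelihood_mem_Icc (hS := hS) (z := z) h0 h1 (h.2 i)).1]

/-- A crude bound, needed for integrability only. -/
lemma dataLikelihood_le {ε : ℝ} (h0 : 0 ≤ ε) (h1 : ε ≤ 1 / 4) {k : ℕ}
    (h : ℝ × (Fin k → EpisodeData S A)) : dataLikelihood hS z ε h ≤ 2 ^ k := by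
  refine (Finset.prod_le_prod (fun i _ => ?_) fun i _ =>
    (likelihood_mem_Icc (hS := hS) (z := z) h0 h1 (h.2 i)).2).trans (by simp)
  linarith [(likelihood_mem_Icc (hS := hS) (z := z) h0 h1 (h.2 i)).1]

/-- Given past data, the algorithm plays the same policy in both models, because they share rewards
and initial state. Hence the likelihood ratios of the episodes multiply. -/
lemma lintegral_dataLaw_bias {ε : Icc (0 : ℝ) (1 / 2)} (hε : (ε : ℝ) ≤ 1 / 4)
    (hz1 : levelStart A e ≤ z.1.1) (hz2 : z.1.1 < levelStart A (e + 1)) (k : ℕ)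
    {F : ℝ × (Fin k → EpisodeData S A) → ℝ≥0∞} (hF : Measurable F) :
    ∫⁻ h, F h ∂(model hS hr (bias z ε)).dataLaw H algo k =
      ∫⁻ h, ENNReal.ofReal (dataLikelihood hS z ε h) * F h
        ∂(model hS hr unbiased).dataLaw H algo k := by
  induction k with
  | zero => simp [dataLikelihood, CTMDP.dataLaw]
  | succ k ih =>
    set M := model hS hr unbiased
    have hZ := (measurable_dataLikelihood (hS := hS) (z := z) ε (k + 1)).ennreal_ofReal
    have hstep := M.measurable_dataStep H algo k
    have hL := (measurable_likelihood (hS := hS) z ε).ennreal_ofReal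
    have hobs := measurable_observe (Q := algo.policy M.r M.x₀ k)
      (algo.measurable_policy M.r M.x₀ k) M.x₀ H
    have hin : ∀ h : ℝ × (Fin k → EpisodeData S A),
        ∫⁻ ω, F (h.1, Fin.snoc h.2 (observe (algo.policy M.r M.x₀ k h) M.x₀ H ω))
          ∂(model hS hr (bias z ε)).noiseLaw =
        ∫⁻ ω, ENNReal.ofReal (likelihood hS z ε (observe (algo.policy M.r M.x₀ k h) M.x₀ H ω)) *
          F (h.1, Fin.snoc h.2 (observe (algo.policy M.r M.x₀ k h) M.x₀ H ω)) ∂M.noiseLaw := by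
      intro h
      refine lintegral_observe_bias (CTMDP.measurable_policy algo M.r M.x₀ k h) hz1 hz2
        (F := fun o => F (h.1, Fin.snoc h.2 o)) (hF.comp (measurable_const.prodMk
          (measurable_pi_iff.2 fun i => ?_)))
      induction i using Fin.lastCases with
      | last => simp only [Fin.snoc_last]; exact measurable_id
      | cast i => simp only [Fin.snoc_castSucc]; exact measurable_const
    have hjoint : Measurable fun q : (ℝ × (Fin k → EpisodeData S A)) × Noise S A =>
        ENNReal.ofReal (likelihood hS z ε (observe (algo.policy M.r M.x₀ k q.1) M.x₀ H q.2)) *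
          F (q.1.1, Fin.snoc q.1.2 (observe (algo.policy M.r M.x₀ k q.1) M.x₀ H q.2)) :=
      (hL.comp hobs).mul (hF.comp hstep)
    rw [CTMDP.lintegral_dataLaw_succ _ H algo k hF,
      CTMDP.lintegral_dataLaw_succ _ H algo k
        (F := fun h => ENNReal.ofReal (dataLikelihood hS z ε h) * F h) (hZ.mul hF)]
    refine (lintegral_congr hin).trans ?_
    rw [ih hjoint.lintegral_prod_right']
    refine lintegral_congr fun h => ?_
    refine (lintegral_const_mul _ (hjoint.comp (measurable_prodMk_left (x := h)))).symm.trans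
      (lintegral_congr fun ω => ?_)
    have hZ0 : 0 ≤ dataLikelihood hS z ε h := (dataLikelihood_pos ε.2.1 hε h).le
    simp only [Function.comp]
    rw [← mul_assoc, ← ENNReal.ofReal_mul hZ0]
    congr 2
    simp only [dataLikelihood, Fin.prod_univ_castSucc, Fin.snoc_castSucc, Fin.snoc_last]

/-- Under the unbiased model, the likelihood ratio of each episode has mean one. -/
lemma lintegral_likelihood {ε : Icc (0 : ℝ) (1 / 2)}
    (hz1 : levelStart A e ≤ z.1.1) (hz2 : z.1.1 < levelStart A (e + 1)) (k : ℕ) (i : Fin k) :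
    ∫⁻ h, ENNReal.ofReal (likelihood hS z ε (h.2 i)) ∂(model hS hr unbiased).dataLaw H algo k =
      1 := by
  have hL := (measurable_likelihood (hS := hS) z ε).ennreal_ofReal
  induction k with
  | zero => exact i.elim0
  | succ k ih =>
    rw [CTMDP.lintegral_dataLaw_succ _ H algo k
      (F := fun h => ENNReal.ofReal (likelihood hS z ε (h.2 i))) (hL.comp (by fun_prop))]
    induction i using Fin.lastCases with
    | last =>
      simp only [Fin.snoc_last]
      have h1 : ∀ h, ∫⁻ ω, ENNReal.ofReal (likelihood hS z ε (observe (algo.policy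
          (model hS hr unbiased).r (root hS) k h) (root hS) H ω))
          ∂(model hS hr unbiased).noiseLaw = 1 := fun h => by
        have := lintegral_observe_bias (hS := hS) (hr := hr) (ε := ε) (H := H)
          (CTMDP.measurable_policy algo (model hS hr unbiased).r (root hS) k h) hz1 hz2
          (F := fun _ => 1) measurable_const
        simpa using this.symm
      exact (lintegral_congr h1).trans (by simp)
    | cast i =>
      simp only [Fin.snoc_castSucc, lintegral_const, measure_univ, mul_one]
      exact ih i

end TreeModel

/-! ### From likelihood ratio to expected number of tests -/

lemma neg_log_one_sub_le {x : ℝ} (hx : |x| ≤ 1 / 2) : -Real.log (1 - x) ≤ x + x ^ 2 := by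
  -- With four Taylor terms, the coefficients of x² are bounded by 1/2 + 1/6 + 1/16 + 1/4 = 47/48;
  -- fewer terms leave too large a remainder at x = 1/2.
  have h := Real.abs_log_sub_add_sum_range_le (show |x| < 1 by linarith) 4
  have h1 := (abs_le.1 h).1
  simp only [Finset.sum_range_succ, Finset.sum_range_zero] at h1
  have h2 : |x| ^ (4 + 1) / (1 - |x|) ≤ x ^ 2 / 4 := by
    rw [div_le_iff₀ (by linarith), ← sq_abs x]
    have h3 : |x| ^ 3 ≤ (1 / 2) ^ 3 := pow_le_pow_left₀ (abs_nonneg x) hx 3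
    have h4 : |x| ^ (4 + 1) = |x| ^ 2 * |x| ^ 3 := by ring
    rw [h4]
    nlinarith [sq_nonneg |x|]
  obtain ⟨h5, h6⟩ := abs_le.1 hx
  have h7 : x ^ 3 ≤ x ^ 2 / 2 := by nlinarith [sq_nonneg x]
  have h8 : x ^ 4 ≤ x ^ 2 / 4 := by nlinarith [sq_nonneg x]
  norm_num at h1
  nlinarith

/-- A pointwise form of an inequality between total variation and relative entropy. -/
lemma sub_one_mul_le {Z w B η : ℝ} (hZ : 0 < Z) (hw : 0 ≤ w) (hwB : w ≤ B) (hη : 0 < η) :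
    (Z - 1) * w ≤ B * ((Z - 1 - Real.log Z) / (4 * η) + η / 2 * (Z + 1) + (Z - 1) / 2) := by
  -- Hellinger's trick: log Z ≤ 2 (s - 1) gives (s - 1)² ≤ Z - 1 - log Z, and |Z - 1| = |s - 1| (s +
  -- 1) is split by the weighted inequality of the means with weight η. Finally (Z - 1) w ≤ B (Z -
  -- 1)⁺.
  set s := √Z with hs
  have hs0 : 0 < s := Real.sqrt_pos.2 hZ
  have hZs : Z = s ^ 2 := (Real.sq_sqrt hZ.le).symm
  have hlog : Real.log Z ≤ 2 * (s - 1) := by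
    rw [hZs, Real.log_pow]
    have := Real.log_le_sub_one_of_pos hs0
    push_cast
    linarith
  have h1 : (s - 1) ^ 2 / (4 * η) ≤ (Z - 1 - Real.log Z) / (4 * η) := by
    gcongr
    rw [hZs] at *
    nlinarith
  have h2 : η / 4 * (s + 1) ^ 2 ≤ η / 2 * (Z + 1) := by
    rw [hZs]
    nlinarith [mul_nonneg hη.le (sq_nonneg (s - 1))]
  have h3 : |s ^ 2 - 1| / 2 ≤ (s - 1) ^ 2 / (4 * η) + η / 4 * (s + 1) ^ 2 := by
    have h4 : (s - 1) ^ 2 / (4 * η) + η / 4 * (s + 1) ^ 2 =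
        ((s - 1) ^ 2 + (η * (s + 1)) ^ 2) / (4 * η) := by
      field_simp
    rw [h4, div_le_div_iff₀ two_pos (by positivity)]
    rcases abs_cases (s ^ 2 - 1) with ⟨h, _⟩ | ⟨h, _⟩ <;> rw [h]
    · nlinarith [sq_nonneg (s - 1 - η * (s + 1))]
    · nlinarith [sq_nonneg (s - 1 + η * (s + 1))]
  have hB : 0 ≤ B := hw.trans hwB
  have h5 : |Z - 1| / 2 + (Z - 1) / 2 ≤
      (Z - 1 - Real.log Z) / (4 * η) + η / 2 * (Z + 1) + (Z - 1) / 2 := by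
    rw [hZs] at h1 h2 ⊢
    linarith
  refine le_trans ?_ (mul_le_mul_of_nonneg_left h5 hB)
  rcases abs_cases (Z - 1) with ⟨h, h'⟩ | ⟨h, h'⟩ <;> rw [h]
  · nlinarith
  · nlinarith

namespace TreeModel

variable {S A e : ℕ} {hS : S = levelStart A (e + 1) + 2} {rate : ℝ} {hr : 0 < rate}
  {H : ℝ} {algo : Algorithm S A} {z : Fin S × Fin A} {K : ℕ}

/-- The number of recorded episodes in which the pair `z` was tested. -/
noncomputable def testCount (e : ℕ) (z : Fin S × Fin A) (h : ℝ × (Fin K → EpisodeData S A)) : ℝ :=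
  ∑ i, (tested e z).indicator (fun _ => (1 : ℝ)) (h.2 i)

lemma measurable_testCount (e : ℕ) (z : Fin S × Fin A) :
    Measurable (testCount (K := K) e z) :=
  Finset.measurable_sum _ fun i _ =>
    (measurable_const.indicator (measurableSet_tested e z)).comp (by fun_prop)

lemma testCount_nonneg (h : ℝ × (Fin K → EpisodeData S A)) : 0 ≤ testCount e z h :=
  Finset.sum_nonneg fun _ _ => indicator_nonneg (fun _ _ => zero_le_one) _

/-- An episode tests at most one pair, since entry `e` of its record determines the pair. -/
lemma sum_testCount_le (s : Finset (Fin S × Fin A)) (h : ℝ × (Fin K → EpisodeData S A)) :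
    ∑ z ∈ s, testCount e z h ≤ K := by
  simp only [testCount]
  rw [Finset.sum_comm]
  refine (Finset.sum_le_card_nsmul _ _ 1 fun i _ => ?_).trans (by simp)
  by_cases hz : ∃ z, h.2 i ∈ tested e z
  · obtain ⟨z, hz⟩ := hz
    have huniq : ∀ z', h.2 i ∈ tested e z' → z' = z := by
      rintro z' ⟨⟨t', ht', h1'⟩, -⟩
      obtain ⟨⟨t, ht, h1⟩, -⟩ := hz
      have : t = t' := Sum.inl_injective (h1.trans h1'.symm)
      subst this
      exact ht'.symm.trans ht
    calc ∑ z' ∈ s, (tested e z').indicator (fun _ => (1 : ℝ)) (h.2 i)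
        ≤ ∑ z' ∈ s, if z' = z then 1 else 0 := by
          refine Finset.sum_le_sum fun z' _ => ?_
          split_ifs with hz'
          · exact indicator_le_self' (fun _ _ => zero_le_one) _
          · rw [indicator_of_notMem fun h' => hz' (huniq z' h')]
      _ ≤ 1 := by
          rw [Finset.sum_ite_eq']
          split_ifs <;> norm_num
  · rw [Finset.sum_eq_zero fun z' _ => indicator_of_notMem (fun h' => hz ⟨z', h'⟩) _]
    exact zero_le_one

/-- The linear terms 1 - L are kept because they have mean zero without bias. The quadratic terms
cost (2ε)² for each test, which bounds the relative entropy without conditioning on the past. -/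
lemma neg_log_dataLikelihood_le {ε : ℝ} (h0 : 0 ≤ ε) (h1 : ε ≤ 1 / 4)
    (h : ℝ × (Fin K → EpisodeData S A)) :
    -Real.log (dataLikelihood hS z ε h) ≤
      (∑ i, (1 - likelihood hS z ε (h.2 i))) + 4 * ε ^ 2 * testCount e z h := by
  rw [dataLikelihood, Real.log_prod fun i _ => by
    linarith [(likelihood_mem_Icc (hS := hS) (z := z) h0 h1 (h.2 i)).1], testCount, Finset.mul_sum,
    ← Finset.sum_neg_distrib, ← Finset.sum_add_distrib]
  refine Finset.sum_le_sum fun i _ => ?_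
  by_cases ht : h.2 i ∈ tested e z
  · rw [likelihood, if_pos ht, indicator_of_mem ht]
    split_ifs
    · have := neg_log_one_sub_le (x := -(2 * ε)) (by rw [abs_neg, abs_of_nonneg] <;> linarith)
      rw [sub_neg_eq_add] at this
      linarith
    · have := neg_log_one_sub_le (x := 2 * ε) (by rw [abs_of_nonneg] <;> linarith)
      linarith
  · rw [likelihood, if_neg ht, indicator_of_notMem ht]
    simp

/-- The mean of a bounded function of the data in the biased model exceeds that in the unbiased
model by an amount controlled by the expected number of tests of the favoured pair. -/
lemma integral_dataLaw_bias_le {ε : Icc (0 : ℝ) (1 / 2)} (hε : (ε : ℝ) ≤ 1 / 4)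
    (hz1 : levelStart A e ≤ z.1.1) (hz2 : z.1.1 < levelStart A (e + 1))
    {W : ℝ × (Fin K → EpisodeData S A) → ℝ} (hW : Measurable W) (hW0 : ∀ h, 0 ≤ W h) {B : ℝ}
    (hWB : ∀ h, W h ≤ B) {η : ℝ} (hη : 0 < η) :
    ∫ h, W h ∂(model hS hr (bias z ε)).dataLaw H algo K ≤
      ∫ h, W h ∂(model hS hr unbiased).dataLaw H algo K +
        B * (ε ^ 2 / η * ∫ h, testCount e z h ∂(model hS hr unbiased).dataLaw H algo K + η) := by
  set P := (model hS hr unbiased).dataLaw H algo K with hP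
  set Z : ℝ × (Fin K → EpisodeData S A) → ℝ := dataLikelihood hS z ε with hZ
  have hZm : Measurable Z := measurable_dataLikelihood ε K
  have hZ0 : ∀ h, 0 < Z h := dataLikelihood_pos ε.2.1 hε
  have hZi : Integrable Z P := Integrable.of_bound hZm.aestronglyMeasurable (2 ^ K)
    (ae_of_all _ fun h => by
      rw [Real.norm_of_nonneg (hZ0 h).le]
      exact dataLikelihood_le ε.2.1 hε h)
  have hWi : Integrable W P := Integrable.of_bound hW.aestronglyMeasurable B
    (ae_of_all _ fun h => by rw [Real.norm_of_nonneg (hW0 h)]; exact hWB h)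
  have hZWi : Integrable (fun h => Z h * W h) P := hZi.mul_bdd (c := B) hW.aestronglyMeasurable
    (ae_of_all _ fun h => by rw [Real.norm_of_nonneg (hW0 h)]; exact hWB h)
  have hNi : Integrable (testCount (K := K) e z) P :=
    Integrable.of_bound (measurable_testCount e z).aestronglyMeasurable K
      (ae_of_all _ fun h => by
        rw [Real.norm_of_nonneg (testCount_nonneg h)]
        simpa using sum_testCount_le (e := e) {z} h)
  have hLm : ∀ i : Fin K, Measurable fun h : ℝ × (Fin K → EpisodeData S A) =>
      likelihood hS z ε (h.2 i) := fun i => (measurable_likelihood z ε).comp (by fun_prop)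
  have hL0 : ∀ (i : Fin K) (h : ℝ × (Fin K → EpisodeData S A)),
      0 ≤ likelihood hS z ε (h.2 i) := fun i h => by
    linarith [(likelihood_mem_Icc (hS := hS) (z := z) ε.2.1 hε (h.2 i)).1]
  have hLi : ∀ i : Fin K, Integrable (fun h : ℝ × (Fin K → EpisodeData S A) =>
      likelihood hS z ε (h.2 i)) P := fun i =>
    Integrable.of_bound (hLm i).aestronglyMeasurable 2 (ae_of_all _ fun h => by
      rw [Real.norm_of_nonneg (hL0 i h)]
      exact (likelihood_mem_Icc (hS := hS) (z := z) ε.2.1 hε (h.2 i)).2)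
  have hL1 : ∀ i : Fin K, ∫ h, likelihood hS z ε (h.2 i) ∂P = 1 := fun i => by
    rw [integral_eq_lintegral_of_nonneg_ae (ae_of_all _ (hL0 i)) (hLm i).aestronglyMeasurable,
      lintegral_likelihood hz1 hz2 K i, ENNReal.toReal_one]
  have hZ1 : ∫ h, Z h ∂P = 1 := by
    have := lintegral_dataLaw_bias (hS := hS) (hr := hr) (H := H) (algo := algo) hε hz1 hz2 K
      (F := fun _ => 1) measurable_const
    simp only [lintegral_const, measure_univ, mul_one] at this
    rw [integral_eq_lintegral_of_nonneg_ae (ae_of_all _ fun h => (hZ0 h).le)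
      hZm.aestronglyMeasurable, ← this, ENNReal.toReal_one]
  have hWZ : ∫ h, W h ∂(model hS hr (bias z ε)).dataLaw H algo K = ∫ h, Z h * W h ∂P := by
    rw [integral_eq_lintegral_of_nonneg_ae (ae_of_all _ hW0) hW.aestronglyMeasurable,
      integral_eq_lintegral_of_nonneg_ae (ae_of_all _ fun h => mul_nonneg (hZ0 h).le (hW0 h))
      (hZm.mul hW).aestronglyMeasurable, lintegral_dataLaw_bias hε hz1 hz2 K hW.ennreal_ofReal]
    congr 1
    exact lintegral_congr fun h => (ENNReal.ofReal_mul (hZ0 h).le).symm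
  -- After log Z has been replaced, the right-hand side is linear in quantities whose means are
  -- known: Z has mean 1 and the sum of the 1 - L has mean 0.
  have hpt : ∀ h, Z h * W h ≤ W h + B * ((Z h - 1 + ((∑ i, (1 - likelihood hS z ε (h.2 i))) +
      4 * (ε : ℝ) ^ 2 * testCount e z h)) / (4 * η) + η / 2 * (Z h + 1) + (Z h - 1) / 2) := by
    intro h
    have h1 := sub_one_mul_le (hZ0 h) (hW0 h) (hWB h) hη
    have h2 := neg_log_dataLikelihood_le (hS := hS) (z := z) ε.2.1 hε h
    have hB : 0 ≤ B := (hW0 h).trans (hWB h)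
    have h3 : (Z h - 1 - Real.log (Z h)) / (4 * η) ≤
        (Z h - 1 + ((∑ i, (1 - likelihood hS z ε (h.2 i))) +
          4 * (ε : ℝ) ^ 2 * testCount e z h)) / (4 * η) := by
      gcongr
      linarith
    have h4 := mul_le_mul_of_nonneg_left h3 hB
    linarith
  set R : ℝ × (Fin K → EpisodeData S A) → ℝ := fun h => ∑ i, (1 - likelihood hS z ε (h.2 i))
    with hR
  set N : ℝ × (Fin K → EpisodeData S A) → ℝ := testCount e z with hN
  have hLi' : ∀ i : Fin K, Integrable (fun h : ℝ × (Fin K → EpisodeData S A) =>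
      1 - likelihood hS z ε (h.2 i)) P := fun i => (integrable_const _).sub (hLi i)
  have hRi : Integrable R P := integrable_finsetSum _ fun i _ => hLi' i
  have hR0 : ∫ h, R h ∂P = 0 := by
    rw [hR, integral_finsetSum _ fun i _ => hLi' i]
    refine Finset.sum_eq_zero fun i _ => ?_
    rw [integral_sub (integrable_const _) (hLi i), hL1]
    simp
  have hcomb : ∀ h, W h + B * ((Z h - 1 + (R h + 4 * (ε : ℝ) ^ 2 * N h)) / (4 * η) +
      η / 2 * (Z h + 1) + (Z h - 1) / 2) =
      W h + (B * (1 / (4 * η) + η / 2 + 1 / 2) * Z h + (B / (4 * η) * R h +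
        (B * (ε ^ 2 / η) * N h + B * (-1 / (4 * η) + η / 2 - 1 / 2)))) := by
    intro h
    field_simp
    ring
  have hi1 : Integrable (fun h => B * ((ε : ℝ) ^ 2 / η) * N h +
      B * (-1 / (4 * η) + η / 2 - 1 / 2)) P := (hNi.const_mul _).add (integrable_const _)
  have hi2 : Integrable (fun h => B / (4 * η) * R h + (B * ((ε : ℝ) ^ 2 / η) * N h +
      B * (-1 / (4 * η) + η / 2 - 1 / 2))) P := (hRi.const_mul _).add hi1
  have hi3 : Integrable (fun h => B * (1 / (4 * η) + η / 2 + 1 / 2) * Z h + (B / (4 * η) * R h +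
      (B * ((ε : ℝ) ^ 2 / η) * N h + B * (-1 / (4 * η) + η / 2 - 1 / 2)))) P :=
    (hZi.const_mul _).add hi2
  rw [hWZ]
  refine (integral_mono hZWi (hWi.add hi3) fun h => (hpt h).trans_eq (hcomb h)).trans_eq ?_
  rw [integral_add' hWi hi3, integral_add (hZi.const_mul _) hi2, integral_add (hRi.const_mul _) hi1,
    integral_add (hNi.const_mul _) (integrable_const _), integral_const_mul, integral_const_mul,
    integral_const_mul, hZ1, hR0]
  simp only [integral_const, probReal_univ, one_smul]
  field_simp
  ring

end TreeModel

/-! ### Regret in the biased models and averaging over the hidden pair -/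

namespace TreeModel

variable {S A e : ℕ} {hS : S = levelStart A (e + 1) + 2} {rate : ℝ} {hr : 0 < rate}
  {H : ℝ} {algo : Algorithm S A} {z : Fin S × Fin A} {K : ℕ}

/-- The policy of the `k`-th episode as a function of the data of `K` episodes. -/
def episodePolicy (M : CTMDP S A) (algo : Algorithm S A) {K : ℕ} (k : Fin K)
    (h : ℝ × (Fin K → EpisodeData S A)) : ControlMap S A :=
  algo.policy M.r M.x₀ k (h.1, fun i => h.2 (Fin.castLE k.2.le i))

lemma measurable_episodePolicy (M : CTMDP S A) (k : Fin K) (x : Fin S) :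
    Measurable fun q : (ℝ × (Fin K → EpisodeData S A)) × ℝ => episodePolicy M algo k q.1 x q.2 :=
  CTMDP.measurable_policy_apply algo M.r M.x₀ k
    (f := fun h : ℝ × (Fin K → EpisodeData S A) => (h.1, fun i => h.2 (Fin.castLE k.2.le i)))
    (by fun_prop) x

lemma measurable_episodePolicy_apply (M : CTMDP S A) (k : Fin K)
    (h : ℝ × (Fin K → EpisodeData S A)) (x : Fin S) : Measurable (episodePolicy M algo k h x) :=
  CTMDP.measurable_policy algo M.r M.x₀ k _ x

/-- The sum over the episodes of the weights with which the pair `z` is hit. -/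
noncomputable def totalHit (hS : S = levelStart A (e + 1) + 2) (hr : 0 < rate) (H : ℝ)
    (algo : Algorithm S A) (z : Fin S × Fin A) (h : ℝ × (Fin K → EpisodeData S A)) : ℝ :=
  ∑ k : Fin K, (hitWeight (model hS hr unbiased) hS rate H
    (episodePolicy (model hS hr unbiased) algo k h) z).toReal

lemma measurable_totalHit :
    Measurable fun h : ℝ × (Fin K → EpisodeData S A) => totalHit hS hr H algo z h :=
  Finset.measurable_sum _ fun k _ => (Measurable.lintegral_prod_right'
    (measurable_hit hr (measurable_episodePolicy (model hS hr unbiased) k) H z)).ennreal_toReal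

lemma totalHit_nonneg (h : ℝ × (Fin K → EpisodeData S A)) : 0 ≤ totalHit hS hr H algo z h :=
  Finset.sum_nonneg fun _ _ => ENNReal.toReal_nonneg

lemma sum_totalHit_le (s : Finset (Fin S × Fin A)) (h : ℝ × (Fin K → EpisodeData S A)) :
    ∑ z ∈ s, totalHit hS hr H algo z h ≤
      K * ∫ t, max (H - t) 0 ∂gammaMeasure ((e + 1 : ℕ) : ℝ) rate := by
  have hG0 : 0 ≤ ∫ t, max (H - t) 0 ∂gammaMeasure ((e + 1 : ℕ) : ℝ) rate :=
    integral_nonneg fun t => le_max_right _ _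
  refine (Finset.sum_le_sum_of_subset_of_nonneg (Finset.subset_univ s)
    fun z _ _ => totalHit_nonneg h).trans ?_
  simp only [totalHit]
  rw [Finset.sum_comm]
  refine (Finset.sum_le_card_nsmul _ _ _ fun k _ => ?_).trans_eq (by
    rw [Finset.card_univ, Fintype.card_fin, nsmul_eq_mul])
  have hπ := measurable_episodePolicy_apply (algo := algo) (model hS hr unbiased) k h
  rw [← ENNReal.toReal_sum fun z _ =>
      ((hitWeight_le (hr := hr) hπ z).trans_lt ENNReal.ofReal_lt_top).ne, sum_hitWeight hπ,
    ENNReal.toReal_ofReal hG0]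

lemma totalHit_le (h : ℝ × (Fin K → EpisodeData S A)) :
    totalHit hS hr H algo z h ≤
      K * ∫ t, max (H - t) 0 ∂gammaMeasure ((e + 1 : ℕ) : ℝ) rate := by
  simpa using sum_totalHit_le (hS := hS) (hr := hr) (H := H) (algo := algo) {z} h

lemma integrable_totalHit {P : Measure (ℝ × (Fin K → EpisodeData S A))} [IsFiniteMeasure P] :
    Integrable (totalHit hS hr H algo z) P :=
  Integrable.of_bound measurable_totalHit.aestronglyMeasurable _ (ae_of_all _ fun h => by
    rw [Real.norm_of_nonneg (totalHit_nonneg h)]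
    exact totalHit_le h)

/-- Values are affine in the hit weights, which do not depend on the bias; the bias still enters
through the law of the data. -/
lemma le_regret_bias {ε : Icc (0 : ℝ) (1 / 2)} (hH : 0 ≤ H) (hz1 : levelStart A e ≤ z.1.1)
    (hz2 : z.1.1 < levelStart A (e + 1)) :
    (ε : ℝ) * (K * (∫ t, max (H - t) 0 ∂gammaMeasure ((e + 1 : ℕ) : ℝ) rate) -
      ∫ h, totalHit hS hr H algo z h ∂(model hS hr (bias z ε)).dataLaw H algo K) ≤
    (model hS hr (bias z ε)).regret H algo K := by
  set G := ∫ t, max (H - t) 0 ∂gammaMeasure ((e + 1 : ℕ) : ℝ) rate with hG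
  set M := model hS hr (bias z ε)
  have hopt : G / 2 + ε * G ≤ M.optValue H (root hS) :=
    le_optValue_bias (hS := hS) (hr := hr) hH hz1 hz2
  have hreg : M.regret H algo K = ∫ h, K * (M.optValue H (root hS) - G / 2) -
      ε * totalHit hS hr H algo z h ∂M.dataLaw H algo K := by
    refine integral_congr_ae (ae_of_all _ fun h => ?_)
    have hv : ∀ k : Fin K, M.value H (algo.policy M.r M.x₀ k
        (h.1, fun i => h.2 (Fin.castLE k.2.le i))) M.x₀ = G / 2 + ε * (hitWeight
          (model hS hr unbiased) hS rate H
          (episodePolicy (model hS hr unbiased) algo k h) z).toReal := fun k => by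
      have hπ := measurable_episodePolicy_apply (algo := algo) (model hS hr unbiased) k h
      rw [← hitWeight_bias (ε := ε) hπ hz1 hz2]
      exact value_bias hπ hH
    simp only [hv, Finset.sum_const, Finset.card_univ, Fintype.card_fin, Finset.sum_add_distrib,
      nsmul_eq_mul, ← Finset.mul_sum]
    simp only [totalHit]
    change (K : ℝ) * M.optValue H (root hS) - _ = _
    ring
  rw [hreg, integral_sub (integrable_const _) (integrable_totalHit.const_mul _),
    integral_const, integral_const_mul]
  simp only [probReal_univ, one_smul]
  have : (K : ℝ) * (G / 2 + ε * G) ≤ K * M.optValue H (root hS) := by gcongr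
  linarith

/-- The pairs of a leaf and an action. -/
def leafPairs (S A e : ℕ) : Finset (Fin S × Fin A) :=
  Finset.univ.filter fun z => levelStart A e ≤ z.1.1 ∧ z.1.1 < levelStart A (e + 1)

include hS in
lemma card_leafPairs : (leafPairs S A e).card = A ^ (e + 1) := by
  have h1 : leafPairs S A e = (Finset.univ.filter fun x : Fin S =>
      levelStart A e ≤ x.1 ∧ x.1 < levelStart A (e + 1)) ×ˢ (Finset.univ : Finset (Fin A)) := by
    ext z
    simp [leafPairs]
  have h2 : (Finset.univ.filter fun x : Fin S =>
      levelStart A e ≤ x.1 ∧ x.1 < levelStart A (e + 1)).card = A ^ e := by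
    rw [← Finset.card_map Fin.valEmbedding]
    have : (Finset.univ.filter fun x : Fin S => levelStart A e ≤ x.1 ∧
        x.1 < levelStart A (e + 1)).map Fin.valEmbedding =
        Finset.Ico (levelStart A e) (levelStart A (e + 1)) := by
      ext n
      simp only [Finset.mem_map, Finset.mem_filter, Finset.mem_univ, true_and, Finset.mem_Ico,
        Fin.valEmbedding_apply]
      constructor
      · rintro ⟨x, hx, rfl⟩; exact hx
      · intro hn
        exact ⟨⟨n, by omega⟩, hn, rfl⟩
    rw [this, Nat.card_Ico, levelStart_succ', Nat.add_sub_cancel_left]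
  rw [h1, Finset.card_product, h2, Finset.card_univ, Fintype.card_fin, pow_succ]

/-- Some bias forces the algorithm to a large regret. -/
lemma exists_le_regret (hH : 0 ≤ H) (hA : 0 < A) (algo : Algorithm S A) (K : ℕ)
    {ε : Icc (0 : ℝ) (1 / 2)} (hε : (ε : ℝ) ≤ 1 / 4) {η : ℝ} (hη : 0 < η) :
    ∃ z : Fin S × Fin A,
      (ε : ℝ) * K * (∫ t, max (H - t) 0 ∂gammaMeasure ((e + 1 : ℕ) : ℝ) rate) *
        (1 - 1 / (A : ℝ) ^ (e + 1) - ((ε : ℝ) ^ 2 * K / (η * (A : ℝ) ^ (e + 1)) + η)) ≤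
      (model hS hr (bias z ε)).regret H algo K := by
  set G := ∫ t, max (H - t) 0 ∂gammaMeasure ((e + 1 : ℕ) : ℝ) rate with hG
  have hG0 : 0 ≤ G := integral_nonneg fun t => le_max_right _ _
  set P := (model hS hr unbiased).dataLaw H algo K with hP
  have hε0 : 0 ≤ (ε : ℝ) := ε.2.1
  have hcard : ((leafPairs S A e).card : ℝ) = (A : ℝ) ^ (e + 1) := by
    rw [card_leafPairs (hS := hS)]; push_cast; rfl
  have hN0 : 0 < (A : ℝ) ^ (e + 1) := by positivity
  set N := (A : ℝ) ^ (e + 1) with hN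
  have hne : (leafPairs S A e).Nonempty := by
    rw [← Finset.card_pos, card_leafPairs (hS := hS)]; positivity
  have hmem : ∀ z ∈ leafPairs S A e, levelStart A e ≤ z.1.1 ∧ z.1.1 < levelStart A (e + 1) :=
    fun z hz => (Finset.mem_filter.1 hz).2
  have htest : ∑ z ∈ leafPairs S A e, ∫ h, testCount e z h ∂P ≤ K := by
    rw [← integral_finsetSum _ fun z _ => Integrable.of_bound
      (measurable_testCount e z).aestronglyMeasurable (K : ℝ) (ae_of_all _ fun h => by
        rw [Real.norm_of_nonneg (testCount_nonneg h)]
        simpa using sum_testCount_le (e := e) {z} h)]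
    refine (integral_mono_of_nonneg (ae_of_all _ fun h =>
      Finset.sum_nonneg fun z _ => testCount_nonneg h) (integrable_const (K : ℝ))
      (ae_of_all _ fun h => sum_testCount_le _ h)).trans (by simp)
  have hhit : ∑ z ∈ leafPairs S A e, ∫ h, totalHit hS hr H algo z h ∂P ≤ K * G := by
    rw [← integral_finsetSum _ fun z _ => integrable_totalHit]
    refine (integral_mono_of_nonneg (ae_of_all _ fun h =>
      Finset.sum_nonneg fun z _ => totalHit_nonneg h) (integrable_const ((K : ℝ) * G))
      (ae_of_all _ fun h => sum_totalHit_le _ h)).trans (by simp)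
  have hreg : ∀ z ∈ leafPairs S A e, (ε : ℝ) * (K * G - (∫ h, totalHit hS hr H algo z h ∂P +
      K * G * ((ε : ℝ) ^ 2 / η * ∫ h, testCount e z h ∂P + η))) ≤
      (model hS hr (bias z ε)).regret H algo K := by
    intro z hz
    obtain ⟨hz1, hz2⟩ := hmem z hz
    refine le_trans ?_ (le_regret_bias (hS := hS) (hr := hr) hH hz1 hz2)
    have := integral_dataLaw_bias_le (hS := hS) (hr := hr) (H := H) (algo := algo) hε hz1 hz2
      (measurable_totalHit (hS := hS) (hr := hr) (H := H) (algo := algo) (z := z) (K := K))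
      totalHit_nonneg totalHit_le hη
    exact mul_le_mul_of_nonneg_left (by linarith) hε0
  -- A sum over the N pairs bounds the best of them; summing uses the total hit weight K G and the
  -- total number K of tests.
  obtain ⟨z, -, hz⟩ := Finset.exists_le_of_sum_le hne (f := fun _ => (ε : ℝ) * K * G *
      (1 - 1 / N - ((ε : ℝ) ^ 2 * K / (η * N) + η)))
      (g := fun z => (model hS hr (bias z ε)).regret H algo K) (by
    refine le_trans ?_ (Finset.sum_le_sum hreg)
    rw [Finset.sum_const]
    simp only [← Finset.mul_sum, Finset.sum_sub_distrib, Finset.sum_add_distrib,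
      Finset.sum_const, nsmul_eq_mul, hcard]
    have h1 : (K : ℝ) * G * ((ε : ℝ) ^ 2 / η * ∑ z ∈ leafPairs S A e, ∫ h, testCount e z h ∂P) ≤
        K * G * (ε ^ 2 / η * K) := by gcongr
    have h2 : N * ((ε : ℝ) * K * G * (1 - 1 / N - ((ε : ℝ) ^ 2 * K / (η * N) + η))) =
        ε * (K * (N * G) - (K * G + K * G * (ε ^ 2 / η * K + N * η))) := by
      field_simp
      ring
    rw [h2]
    refine mul_le_mul_of_nonneg_left ?_ hε0
    linarith)
  exact ⟨z, hz⟩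

end TreeModel

/-! ### Numerical constants and conclusion -/

lemma card_leafPairs_bounds {S A d : ℕ} (hS : 6 ≤ S) (hA : 2 ≤ A)
    (hSd : S = levelStart A d + 2) :
    8 ≤ A ^ d ∧ 4 * (S * A) ≤ 9 * A ^ d ∧ A ^ d ≤ S * A := by
  obtain ⟨a, rfl⟩ := Nat.exists_eq_add_of_le hA
  have hpow : (2 + a) ^ d + (1 + a) * 2 = (1 + a) * S + 1 := by
    have h1 := levelStart_succ (2 + a) d
    rw [levelStart_succ'] at h1
    rw [hSd]
    nlinarith
  -- For A = 2 the number of states is 2^d + 1, so S ≥ 6 forces S ≥ 9. The case A = 2, d = 3 gives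
  -- equality in 4 S A ≤ 9 A^d.
  have h9 : a = 0 → 9 ≤ S := by
    rintro rfl
    have h2 : 2 ^ d + 1 = S := by simp at hpow; omega
    have : 2 < d := by
      by_contra h
      have : 2 ^ d ≤ 2 ^ 2 := Nat.pow_le_pow_right (by norm_num) (by omega)
      omega
    have : 2 ^ 3 ≤ 2 ^ d := Nat.pow_le_pow_right (by norm_num) this
    omega
  rcases Nat.eq_zero_or_pos a with rfl | ha
  · have := h9 rfl
    omega
  · refine ⟨?_, ?_, ?_⟩ <;> nlinarith

theorem theorem2 (S A d : ℕ) (hS : 6 ≤ S) (hA : 2 ≤ A)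
    (hd : (S : ℝ) = 2 + ((A : ℝ) ^ d - 1) / ((A : ℝ) - 1))
    (H rateMin rateMax : ℝ) (hH : 0 < H) (hmin : 0 < rateMin) (hmax : rateMin ≤ rateMax)
    (algo : Algorithm S A) (K : ℕ) (hK : (S : ℝ) * (A : ℝ) / 2 ≤ (K : ℝ)) :
    ∃ M ∈ ctmdpClass S A rateMin rateMax,
      1 / (12 * Real.sqrt 2) * (∫ g, max (H - g) 0 ∂(gammaMeasure (d : ℝ) rateMax))
          * Real.sqrt ((S : ℝ) * (A : ℝ) * (K : ℝ)) ≤ M.regret H algo K ∧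
      ∀ c₂ : ℝ, 0 < c₂ → c₂ < 1 → (d : ℝ) < (1 - c₂) * rateMax * H →
        c₂ / (12 * Real.sqrt 2) * H * Real.sqrt ((S : ℝ) * (A : ℝ) * (K : ℝ))
          ≤ M.regret H algo K := by
  have hr : 0 < rateMax := hmin.trans_le hmax
  have hA1 : (A : ℝ) ≠ 1 := by
    have : (2 : ℝ) ≤ A := by exact_mod_cast hA
    linarith
  have hSd : S = levelStart A d + 2 := by
    have : (S : ℝ) = ((levelStart A d + 2 : ℕ) : ℝ) := by
      rw [hd, levelStart]
      push_cast
      rw [geom_sum_eq hA1]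
      ring
    exact_mod_cast this
  obtain ⟨hN8, hN4, hN1⟩ := card_leafPairs_bounds hS hA hSd
  obtain ⟨e, rfl⟩ : ∃ e, d = e + 1 := by
    rcases d with _ | e
    · simp at hN8
    · exact ⟨e, rfl⟩
  set G := ∫ g, max (H - g) 0 ∂(gammaMeasure ((e + 1 : ℕ) : ℝ) rateMax) with hG
  have hG0 : 0 ≤ G := integral_nonneg fun t => le_max_right _ _
  set N := (A : ℝ) ^ (e + 1) with hN
  have hN8' : 8 ≤ N := by rw [hN]; exact_mod_cast hN8
  have hN4' : 4 * ((S : ℝ) * A) ≤ 9 * N := by rw [hN]; exact_mod_cast hN4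
  have hN1' : N ≤ S * A := by rw [hN]; exact_mod_cast hN1
  have hK0 : 0 < (K : ℝ) := by linarith
  have hsqrt2 : 0 < √(2 : ℝ) := by positivity
  -- The choices ε = c √(N/K) and η = c make both error terms equal to c. Since N ≤ S A ≤ 2K, the
  -- factor 1/√2 in c gives ε ≤ 1/4.
  set c : ℝ := 1 / (4 * √2) with hc
  have hc0 : 0 < c := by positivity
  have hε0 : 0 ≤ c * √(N / K) := by positivity
  have hε1 : c * √(N / K) ≤ 1 / 4 := by
    have h1 : √(N / K) ≤ √2 := by
      apply Real.sqrt_le_sqrt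
      rw [div_le_iff₀ hK0]
      linarith
    calc c * √(N / K) ≤ c * √2 := by gcongr
      _ = 1 / 4 := by rw [hc]; field_simp
  obtain ⟨z, hz⟩ := TreeModel.exists_le_regret (hS := hSd) (hr := hr) hH.le (by omega) algo K
    (ε := ⟨c * √(N / K), hε0, by linarith⟩) hε1 hc0
  have hmain : 1 / (12 * √2) * G * √((S : ℝ) * A * K) ≤
      (TreeModel.model hSd hr (TreeModel.bias z ⟨c * √(N / K), hε0, by linarith⟩)).regret
        H algo K := by
    refine le_trans ?_ hz
    simp only [← hG, ← hN]
    have hNK : √(N / K) * K = √(N * K) := by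
      rw [Real.sqrt_div' _ hK0.le, Real.sqrt_mul' _ hK0.le]
      have : √(K : ℝ) * √K = K := Real.mul_self_sqrt hK0.le
      have hne : √(K : ℝ) ≠ 0 := (Real.sqrt_pos.2 hK0).ne'
      field_simp
      linarith
    have hterm : (c * √(N / K)) ^ 2 * K / (c * N) + c = 2 * c := by
      rw [mul_pow, Real.sq_sqrt (by positivity)]
      field_simp
      ring
    rw [hterm]
    -- With 2c ≤ 3/8, the bracket 1 - 1/N - 2c is at least 1/2.
    have h8 : 1 / N ≤ 1 / 8 := by gcongr
    have hc2 : 2 * c ≤ 3 / 8 := by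
      have : (4 / 3 : ℝ) ≤ √2 := Real.le_sqrt_of_sq_le (by norm_num)
      rw [hc, mul_one_div, div_le_iff₀ (by positivity)]
      linarith
    -- From N ≥ (4/9) S A; together, c · (2/3) · (1/2) = c/3 = 1/(12√2).
    have hroot : 2 / 3 * √((S : ℝ) * A * K) ≤ √(N * K) := by
      apply Real.le_sqrt_of_sq_le
      rw [mul_pow, Real.sq_sqrt (by positivity)]
      nlinarith
    have hcc : 1 / (12 * √2) = c / 3 := by rw [hc]; field_simp; norm_num
    rw [hcc]
    calc c / 3 * G * √((S : ℝ) * A * K) = c * G * (2 / 3 * √((S : ℝ) * A * K)) * (1 / 2) := by ring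
      _ ≤ c * G * √(N * K) * (1 - 1 / N - 2 * c) := by
        gcongr
        linarith
      _ = c * √(N / K) * K * G * (1 - 1 / N - 2 * c) := by rw [← hNK]; ring
  refine ⟨_, ⟨fun x a => ⟨hmax, le_rfl⟩, fun x a => ?_⟩, hmain, fun c₂ h0 h1 h2 => ?_⟩
  · simp only [TreeModel.model]
    split_ifs <;> simp
  · refine le_trans ?_ hmain
    -- The Erlang mean d / λ is at most (1 - c₂) H, so G ≥ H - d / λ ≥ c₂ H.
    have hGH : c₂ * H ≤ G := by
      refine le_trans ?_ (le_integral_remaining_gammaMeasure (by positivity) hr)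
      have : ((e + 1 : ℕ) : ℝ) / rateMax ≤ (1 - c₂) * H := by
        rw [div_le_iff₀ hr]
        linarith
      linarith
    have : c₂ / (12 * √2) * H = 1 / (12 * √2) * (c₂ * H) := by ring
    rw [this]
    gcongr
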